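/- Let $J$ be a half line Jacobi matrix on $\ell^2(\{1,2,\dots\})$, $(Ju)(n)=a(n)u(n+1)+a(n-1)u(n-1)+b(n)u(n)$ (with $u(0)=0$ here), with real coefficients satisfying $(C+1)^{-1}\le a(n)\le C+1$ and $|b(n)|\le C$ for all $n\ge 1$ and some $C>0$; put $a(0)=1$. For $z\in\mathbb C^+=\{\operatorname{Im}z>0\}$ let $m_+(z)=\langle\delta_1,(J-z)^{-1}\delta_1\rangle$, let $f_+(\cdot,z)$ be the solution of $a(n)f(n+1)+a(n-1)f(n-1)+b(n)f(n)=zf(n)$, $n\ge 1$, with $f_+(0,z)=1$, $f_+(1,z)=-m_+(z)$, and put $$m_+(n,z)=-\frac{f_+(n+1,z)}{a(n)f_+(n,z)},\qquad w_+^{(N)}(z)=\frac1N\sum_{n=1}^N\ln\bigl[a(n)m_+(n,z)\bigr],$$ where $0<\operatorname{Im}\ln\zeta<\pi$ for $\zeta\in\mathbb C^+$. Let $N_j\to\infty$ be a sequence of integers such that $w_+^{(N_j)}\to w_+$ uniformly on compact subsets of $\mathbb C^+$ for some holomorphic $w_+:\mathbb C^+\to\mathbb C^+$, and let $\gamma(z)=-\operatorname{Re}w_+(z)$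 be the associated generalized Lyapunov exponent. Then: 1. The limit $\gamma(t)=\lim_{y\to0+}\gamma(t+iy)$ exists in $\mathbb R$ for every $t\in\mathbb R$. 2. For every $x\in\mathbb R$, every $\varepsilon>0$ and every real $N\ge1$, $$\operatorname{cap}\bigl(\{y\in(x-h,x+h):|\gamma(y)-\gamma(x)|\ge\varepsilon\}\bigr)=o(h^N)\qquad(h\to0+),$$ where $\operatorname{cap}(S)=\sup_\mu e^{I(\mu)}$ is the logarithmic capacity; here $I(\mu)=\iint\ln|s-t|\,d\mu(s)\,d\mu(t)\in[-\infty,\infty)$, the supremum is over all Borel probability measures $\mu$ supported by a compact subset of $S$, $e^{-\infty}=0$, and $\operatorname{cap}(\emptyset)=0$. 3. Consequently the function $\gamma:\mathbb R\to\mathbb R$ is approximately continuous at every $x\in\mathbb R$: it is measurable and, for every $\varepsilon>0$, the Lebesgue measure of $\{y\in(x-h,x+h):|\gamma(y)-\gamma(x)|\ge\varepsilon\}$ divided by $2h$ tends to $0$ as $h\to0+$. -/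

import Mathlib

open Filter Topology MeasureTheory Set
open scoped ENNReal

/-! ### Half line Jacobi matrices -/

/-- The coefficients of a half line Jacobi matrix
`(J u)(n) = a(n) u(n+1) + a(n-1) u(n-1) + b(n) u(n)` on `ℓ²({1, 2, …})`, where
`(C+1)⁻¹ ≤ a(n) ≤ C+1` and `|b(n)| ≤ C` for `n ≥ 1`.  The convention is `a(0) = 1`;
the value `b 0` is never used. -/
structure JacobiMatrix where
  a : ℕ → ℝ
  b : ℕ → ℝ
  a_zero : a 0 = 1
  bounds : ∃ C : ℝ, 0 < C ∧ ∀ n : ℕ, 1 ≤ n → (C + 1)⁻¹ ≤ a n ∧ a n ≤ C + 1 ∧ |b n| ≤ C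

/-- The Hilbert space `ℓ²({1, 2, …})`; the entry with index `k : ℕ` is the value at the
site `k + 1`. -/
abbrev EllTwo : Type := lp (fun _ : ℕ => ℂ) 2

namespace JacobiMatrix

/-- The action of the Jacobi matrix on sequences; the entry `k` belongs to the site `k + 1`, and
`u` is taken to be zero at the site `0`. -/
noncomputable def act (J : JacobiMatrix) (u : ℕ → ℂ) : ℕ → ℂ
  | 0 => (J.a 1 : ℂ) * u 1 + (J.b 1 : ℂ) * u 0
  | k + 1 => (J.a (k + 2) : ℂ) * u (k + 2) + (J.a (k + 1) : ℂ) * u k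
      + (J.b (k + 2) : ℂ) * u (k + 1)

theorem memlp_act (J : JacobiMatrix) {u : ℕ → ℂ} (hu : Memℓp u 2) : Memℓp (J.act u) 2 := by
  obtain ⟨C, hC, hb⟩ := J.bounds
  have h2 : (0 : ℝ) < (2 : ℝ≥0∞).toReal := by norm_num
  have hs : Summable fun k => ‖u k‖ ^ (2 : ℝ) := by simpa using hu.summable h2
  have key : ∀ (c : ℕ → ℝ) (v : ℕ → ℂ), (∀ n, |c n| ≤ C + 1) →
      (Summable fun k => ‖v k‖ ^ (2 : ℝ)) → Memℓp (fun k => (c k : ℂ) * v k) 2 := by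
    intro c v hc hv
    refine memℓp_gen ?_
    refine Summable.of_nonneg_of_le (fun k => by positivity) (fun k => ?_)
      (hv.mul_left ((C + 1) ^ (2 : ℝ)))
    rw [norm_mul, Complex.norm_real, Real.norm_eq_abs]
    simp only [ENNReal.toReal_ofNat]
    rw [Real.mul_rpow (abs_nonneg _) (norm_nonneg _)]
    gcongr
    exact hc k
  have ha : ∀ n, |J.a (n + 1)| ≤ C + 1 := by
    intro n
    obtain ⟨h1, h3, -⟩ := hb (n + 1) (by omega)
    have : (0 : ℝ) < (C + 1)⁻¹ := by positivity
    rw [abs_of_pos (by linarith)]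
    exact h3
  have hbb : ∀ n, |J.b (n + 1)| ≤ C + 1 := fun n => by
    linarith [(hb (n + 1) (by omega)).2.2]
  have m1 := key (fun k => J.a (k + 1)) (fun k => u (k + 1)) ha
    (hs.comp_injective (add_left_injective 1))
  have m2 := key (fun k => J.b (k + 1)) u hbb hs
  have m3 := key (fun k => J.a k) (fun k => k.casesOn 0 u)
    (fun n => by
      cases n with
      | zero => rw [J.a_zero]; norm_num; linarith
      | succ n => exact ha n)
    ((summable_nat_add_iff 1).1 (by simpa using hs))
  refine ((m1.add m3).add m2).mono' ?_
  intro k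
  cases k with
  | zero => simp [act]
  | succ k => simp [act]

/-- The Jacobi operator `J` as a bounded operator on `ℓ²({1, 2, …})`. -/
noncomputable def op (J : JacobiMatrix) : EllTwo →L[ℂ] EllTwo :=
  ContinuousLinearMap.ofSeqClosedGraph
    (g :=
      { toFun := fun u => ⟨J.act u, J.memlp_act (lp.memℓp u)⟩
        map_add' := by
          intro u v
          ext k
          change J.act (⇑u + ⇑v) k = J.act u k + J.act v k
          cases k <;> simp [act] <;> ring
        map_smul' := by
          intro c u
          ext k
          change J.act (c • ⇑u) k = c * J.act u k
          cases k <;> simp [act] <;> ring })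
    (by
      intro s x y hx hy
      have hev : ∀ (t : ℕ → EllTwo) (z : EllTwo), Tendsto t atTop (𝓝 z) →
          ∀ k, Tendsto (fun n => t n k) atTop (𝓝 (z k)) := fun t z ht k =>
        ((lp.evalCLM ℂ (fun _ : ℕ => ℂ) 2 k).continuous.tendsto z).comp ht
      ext k
      refine tendsto_nhds_unique (hev _ _ hy k) ?_
      cases k with
      | zero =>
        exact ((hev _ _ hx 1).const_mul _).add ((hev _ _ hx 0).const_mul _)
      | succ k =>
        exact (((hev _ _ hx (k + 2)).const_mul _).add ((hev _ _ hx k).const_mul _)).add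
          ((hev _ _ hx (k + 1)).const_mul _))

theorem op_apply (J : JacobiMatrix) (u : EllTwo) (k : ℕ) : J.op u k = J.act u k := rfl

/-- The vector `δ₁`, the unit vector at the site `1`. -/
noncomputable def deltaOne : EllTwo := lp.single 2 0 1

/-- The Titchmarsh-Weyl function `m₊(z) = ⟨δ₁, (J - z)⁻¹ δ₁⟩`. -/
noncomputable def mPlus (J : JacobiMatrix) (z : ℂ) : ℂ :=
  inner ℂ deltaOne (Ring.inverse (J.op - algebraMap ℂ (EllTwo →L[ℂ] EllTwo) z) deltaOne)

/-- The solution `f₊(·, z)` of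
`a(n) f(n+1) + a(n-1) f(n-1) + b(n) f(n) = z f(n)`, `n ≥ 1`, with the initial values
`f₊(0, z) = 1`, `f₊(1, z) = -m₊(z)`. -/
noncomputable def fPlus (J : JacobiMatrix) (z : ℂ) : ℕ → ℂ
  | 0 => 1
  | 1 => -J.mPlus z
  | n + 2 => ((z - (J.b (n + 1) : ℂ)) * fPlus J z (n + 1) - (J.a n : ℂ) * fPlus J z n)
      / (J.a (n + 1) : ℂ)

/-- `m₊(n, z) = - f₊(n+1, z) / (a(n) f₊(n, z))`. -/
noncomputable def mPlusAt (J : JacobiMatrix) (n : ℕ) (z : ℂ) : ℂ :=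
  -(J.fPlus z (n + 1) / ((J.a n : ℂ) * J.fPlus z n))

/-- `w₊^{(N)}(z) = (1/N) ∑_{n=1}^N ln [a(n) m₊(n, z)]`; on the upper half plane the logarithm is
the branch with imaginary part in `(0, π)`. -/
noncomputable def wPlus (J : JacobiMatrix) (N : ℕ) (z : ℂ) : ℂ :=
  (1 / (N : ℂ)) * ∑ n ∈ Finset.Icc 1 N, Complex.log ((J.a n : ℂ) * J.mPlusAt n z)

end JacobiMatrix

/-! ### Herglotz functions, generalized Lyapunov exponents -/

/-- The open upper half plane `ℂ⁺`. -/
def upperHalf : Set ℂ := {z | 0 < z.im}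

/-- A Herglotz function is a holomorphic map of the upper half plane to itself. -/
def IsHerglotz (F : ℂ → ℂ) : Prop :=
  DifferentiableOn ℂ F upperHalf ∧ MapsTo F upperHalf upperHalf

/-- `w₊^{(N_j)} → w₊` uniformly on compact subsets of the upper half plane, for the Herglotz
function `w₊ = w`. -/
def JacobiMatrix.ConvergesAlong (J : JacobiMatrix) (N : ℕ → ℕ) (w : ℂ → ℂ) : Prop :=
  IsHerglotz w ∧ ∀ K : Set ℂ, IsCompact K → K ⊆ upperHalf →
    TendstoUniformlyOn (fun j z => J.wPlus (N j) z) w atTop K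

/-- `γ(z) = - Re w₊(z)` on the upper half plane. -/
noncomputable def lyapunovUpper (w : ℂ → ℂ) (z : ℂ) : ℝ := -(w z).re

/-- The boundary values `γ(t) = lim_{y → 0+} γ(t + i y)` on the real line. -/
noncomputable def lyapunov (w : ℂ → ℂ) (t : ℝ) : ℝ :=
  limUnder (𝓝[>] (0 : ℝ)) fun y : ℝ => lyapunovUpper w ((t : ℂ) + (y : ℂ) * Complex.I)

/-! ### Logarithmic capacity -/

/-- The logarithmic energy `I(μ) = ∬ ln |s - t| dμ(s) dμ(t)` as an extended real number, that is,
the integral of the positive part minus the integral of the negative part; `ln 0 = -∞` on the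
diagonal. For a finite measure with bounded support the first integral is finite. -/
noncomputable def logEnergy (μ : Measure ℝ) : EReal :=
  ((∫⁻ t, ∫⁻ s, (ENNReal.log (edist s t)).toENNReal ∂μ ∂μ : ℝ≥0∞) : EReal)
    - ((∫⁻ t, ∫⁻ s, (-ENNReal.log (edist s t)).toENNReal ∂μ ∂μ : ℝ≥0∞) : EReal)

/-- The logarithmic capacity `cap S = sup_μ exp I(μ)`; the supremum is over all Borel probability
measures `μ` that are supported by a compact subset of `S`, and `exp (-∞) = 0`. -/
noncomputable def logCapacity (S : Set ℝ) : ℝ≥0∞ :=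
  ⨆ (μ : Measure ℝ) (_ : IsProbabilityMeasure μ ∧ ∃ K : Set ℝ, IsCompact K ∧ K ⊆ S ∧ μ Kᶜ = 0),
    EReal.exp (logEnergy μ)

/-! ### Approximate continuity -/

/-- `A(x, ε; f) = {y : |f(y) - f(x)| ≥ ε}`. -/
def deviationSet (f : ℝ → ℝ) (x ε : ℝ) : Set ℝ := {y | ε ≤ |f y - f x|}

/-- `f` is approximately continuous at `x`: it is measurable and, for every `ε > 0`,
`|A(x, ε; f) ∩ (x-h, x+h)| / (2h) → 0` as `h → 0+`. -/
def IsApproxContinuousAt (f : ℝ → ℝ) (x : ℝ) : Prop :=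
  Measurable f ∧ ∀ ε : ℝ, 0 < ε →
    Tendsto (fun h : ℝ =>
        volume (deviationSet f x ε ∩ Ioo (x - h) (x + h)) / ENNReal.ofReal (2 * h))
      (𝓝[>] 0) (𝓝 0)

/-! ### The Weyl solution and its decay -/

namespace JacobiMatrix

variable (J : JacobiMatrix)

/-! The exponent is a logarithmic potential. The Wronskian of the Weyl solution with the monic
orthogonal polynomials (`wronskian_orthPoly`) ties the decay of `f₊` to the growth of the
polynomials, up to a factor bounded above and away from zero. With the telescoping formula
`re_wPlus` and a weak limit `κ` of the zero distributions this yields `γ(z) = ∫ ln |z - s| dκ(s) -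
A` on the upper half plane (`exists_thouless`), while decay of `f₊` gives `γ ≥ 0` there. By Fatou,
this lower bound makes `ln |t - s|` integrable against `κ` for every real `t`
(`ae_ne_and_integrable`). Hence the boundary values exist everywhere, and `γ(t) ≤ γ(t + iy)` makes
them upper semicontinuous.

So near `x` only downward deviations matter. Suppose `γ ≤ γ(x) - ε` on a compact set within `r²` of
`x` that carries a probability measure `μ` whose energy is at most a fixed multiple of `ln (1/r)`.
Restrict `μ` to a part of mass at least `1/4` with bounded potential
(`exists_compact_potential_le`), integrate the deviation against it and exchange the integrals.
Charges of `κ` farther than `r` from `x` act almost equally at `x` and on the set; the nearer ones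
contribute at most a multiple of `ln (1/r) κ(B_r(x))`, which tends to zero by integrability at `x`.
This contradicts `ε > 0` for small `r` (`deviation_le`). Thus energies on the deviation set exceed
`N ln (1/h)` for every `N`. This is the capacity bound, and testing it on normalized Lebesgue
measure gives density zero. -/

theorem a_pos (n : ℕ) : 0 < J.a n := by
  obtain ⟨C, hC, hb⟩ := J.bounds
  rcases Nat.eq_zero_or_pos n with rfl | hn
  · rw [J.a_zero]; exact one_pos
  · exact lt_of_lt_of_le (by positivity) (hb n hn).1

theorem exists_bound : ∃ C : ℝ, 0 < C ∧ (∀ n, (C + 1)⁻¹ ≤ J.a n ∧ J.a n ≤ C + 1) ∧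
    ∀ n, |J.b (n + 1)| ≤ C := by
  obtain ⟨C, hC, hb⟩ := J.bounds
  refine ⟨C, hC, fun n => ?_, fun n => (hb (n + 1) (by omega)).2.2⟩
  rcases Nat.eq_zero_or_pos n with rfl | hn
  · rw [J.a_zero]
    exact ⟨inv_le_one_of_one_le₀ (by linarith), by linarith⟩
  · exact ⟨(hb n hn).1, (hb n hn).2.1⟩

theorem tendsto_lp_zero (u : EllTwo) : Tendsto (fun k => u k) atTop (𝓝 0) := by
  have h2 : (0 : ℝ) < (2 : ℝ≥0∞).toReal := by norm_num
  have hs : Summable fun k => ‖u k‖ ^ (2 : ℝ) := by simpa using (lp.memℓp u).summable h2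
  have h := hs.tendsto_atTop_zero.rpow_const (p := (1 / 2 : ℝ)) (Or.inr (by norm_num))
  rw [tendsto_zero_iff_norm_tendsto_zero]
  refine (h.congr fun k => ?_).trans (by simp)
  rw [← Real.rpow_mul (norm_nonneg _)]
  norm_num

/-- The Wronskian-type boundary term of two sequences at the sites `k`, `k + 1`. -/
noncomputable def boundaryTerm (u v : ℕ → ℂ) : ℕ → ℂ
  | 0 => 0
  | k + 1 => (J.a (k + 1) : ℂ) * (u (k + 1) * star (v k) - u k * star (v (k + 1)))

theorem boundaryTerm_succ_sub (u v : ℕ → ℂ) (k : ℕ) :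
    J.act u k * star (v k) - u k * star (J.act v k)
      = J.boundaryTerm u v (k + 1) - J.boundaryTerm u v k := by
  cases k <;> simp [act, boundaryTerm] <;> ring

theorem tendsto_boundaryTerm (u v : EllTwo) :
    Tendsto (J.boundaryTerm u v) atTop (𝓝 0) := by
  obtain ⟨C, hC, ha, -⟩ := J.exists_bound
  rw [← tendsto_add_atTop_iff_nat 1]
  have hu := tendsto_lp_zero u
  have hv : Tendsto (fun k => star (v k)) atTop (𝓝 0) := by
    simpa using (tendsto_lp_zero v).star
  have h1 : Tendsto (fun k => u (k + 1) * star (v k) - u k * star (v (k + 1))) atTop (𝓝 0) := by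
    simpa using (((tendsto_add_atTop_iff_nat 1).2 hu).mul hv).sub
      (hu.mul ((tendsto_add_atTop_iff_nat 1).2 hv))
  refine squeeze_zero_norm (fun k => ?_) (by simpa only [norm_zero, mul_zero] using h1.norm.const_mul (C + 1))
  simp only [boundaryTerm]
  rw [norm_mul, Complex.norm_real, Real.norm_eq_abs, abs_of_pos (J.a_pos _)]
  gcongr
  exact (ha _).2

/-- Green's formula: partial sums of the difference telescope to a boundary term, which vanishes at
infinity. -/
theorem inner_op (u v : EllTwo) : inner ℂ (J.op v) u = inner ℂ v (J.op u) := by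
  have h1 := (lp.hasSum_inner (𝕜 := ℂ) v (J.op u)).sub (lp.hasSum_inner (𝕜 := ℂ) (J.op v) u)
  have h2 := h1.tendsto_sum_nat
  have h3 : Tendsto (fun n => J.boundaryTerm u v n) atTop
      (𝓝 (inner ℂ v (J.op u) - inner ℂ (J.op v) u)) := by
    refine h2.congr fun n => ?_
    have : J.boundaryTerm u v n = J.boundaryTerm u v n - J.boundaryTerm u v 0 := by
      simp [boundaryTerm]
    rw [this, ← Finset.sum_range_sub]
    refine Finset.sum_congr rfl fun k _ => ?_
    rw [← boundaryTerm_succ_sub]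
    simp [op_apply]
  exact (sub_eq_zero.1 (tendsto_nhds_unique h3 (J.tendsto_boundaryTerm u v))).symm

theorem isSelfAdjoint_op : IsSelfAdjoint J.op := by
  rw [ContinuousLinearMap.isSelfAdjoint_iff_isSymmetric]
  intro u v
  exact J.inner_op v u

/-- The vector `(J - z)⁻¹ δ₁`. -/
theorem exists_resolvent_vector {z : ℂ} (hz : 0 < z.im) : ∃ ψ : EllTwo,
    (∀ k, J.act ψ k - z * ψ k = if k = 0 then 1 else 0) ∧ ψ 0 = J.mPlus z := by
  have hu : IsUnit (J.op - algebraMap ℂ (EllTwo →L[ℂ] EllTwo) z) := by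
    by_contra h
    have hmem : z ∈ spectrum ℂ J.op := by
      rw [spectrum.mem_iff]
      intro h'
      exact h (by simpa using h'.neg)
    have := J.isSelfAdjoint_op.mem_spectrum_eq_re hmem
    rw [this] at hz
    simp at hz
  refine ⟨Ring.inverse (J.op - algebraMap ℂ (EllTwo →L[ℂ] EllTwo) z) deltaOne, fun k => ?_, ?_⟩
  · have h : (J.op - algebraMap ℂ (EllTwo →L[ℂ] EllTwo) z)
        (Ring.inverse (J.op - algebraMap ℂ (EllTwo →L[ℂ] EllTwo) z) deltaOne) = deltaOne :=
      congrArg (fun T : EllTwo →L[ℂ] EllTwo => T deltaOne) (Ring.mul_inverse_cancel _ hu)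
    have h' : (deltaOne : EllTwo) k = if k = 0 then 1 else 0 := by
      simp [deltaOne, lp.single_apply, Pi.single_apply]
    rw [← h']
    exact congrArg (fun v : EllTwo => v k) h
  · rw [mPlus, deltaOne, lp.inner_single_left]
    simp

section Weyl

variable {z : ℂ}

theorem fPlus_rec (n : ℕ) : (J.a (n + 1) : ℂ) * J.fPlus z (n + 2)
    = (z - (J.b (n + 1) : ℂ)) * J.fPlus z (n + 1) - (J.a n : ℂ) * J.fPlus z n := by
  have : (J.a (n + 1) : ℂ) ≠ 0 := by exact_mod_cast (J.a_pos _).ne'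
  rw [fPlus]
  field_simp

/-- Shifted by one site, the Weyl solution is minus the resolvent vector: the source `δ₁` plays the
role of `a(0) f₊(0) = 1`. It is therefore square summable. -/
theorem tendsto_fPlus (hz : 0 < z.im) : Tendsto (J.fPlus z) atTop (𝓝 0) := by
  obtain ⟨ψ, hψ, h0⟩ := J.exists_resolvent_vector hz
  have key : ∀ n, J.fPlus z (n + 1) = -ψ n ∧ J.fPlus z (n + 2) = -ψ (n + 1) := by
    intro n
    induction n with
    | zero =>
      have h1 : J.fPlus z 1 = -ψ 0 := by rw [h0, fPlus]
      refine ⟨h1, ?_⟩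
      have ha : (J.a 1 : ℂ) ≠ 0 := by exact_mod_cast (J.a_pos _).ne'
      refine mul_left_cancel₀ ha ?_
      have h2 := J.fPlus_rec (z := z) 0
      have h3 := hψ 0
      simp only [act, if_true] at h3
      simp only [zero_add] at h2 ⊢
      rw [h2, h1, J.a_zero, fPlus]
      push_cast
      linear_combination h3
    | succ n ih =>
      refine ⟨ih.2, ?_⟩
      have ha : (J.a (n + 2) : ℂ) ≠ 0 := by exact_mod_cast (J.a_pos _).ne'
      refine mul_left_cancel₀ ha ?_
      have h2 := J.fPlus_rec (z := z) (n + 1)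
      have h3 := hψ (n + 1)
      simp only [act, Nat.succ_ne_zero, if_false] at h3
      rw [show n + 1 + 2 = n + 3 by rfl, show n + 1 + 1 = n + 2 by rfl] at *
      rw [h2, ih.1, ih.2]
      linear_combination h3
  rw [← tendsto_add_atTop_iff_nat 1]
  simpa using ((tendsto_lp_zero ψ).neg).congr fun n => (key n).1.symm

/-- The imaginary part of the boundary term of the Weyl solution with itself. -/
noncomputable def weylFlux (z : ℂ) (k : ℕ) : ℝ :=
  J.a k * (J.fPlus z (k + 1) * star (J.fPlus z k)).im

theorem weylFlux_succ_sub (k : ℕ) : J.weylFlux z (k + 1) - J.weylFlux z k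
    = z.im * ‖J.fPlus z (k + 1)‖ ^ 2 := by
  have h := congrArg (fun w => (w * star (J.fPlus z (k + 1))).im) (J.fPlus_rec (z := z) k)
  simp only [weylFlux, show k + 1 + 1 = k + 2 by rfl]
  rw [← Complex.normSq_eq_norm_sq, Complex.normSq_apply]
  simp at h ⊢
  linear_combination h

/-- The flux increases to its limit `0`, so it is nonpositive at `n + 1`; the last increment is then
subtracted. -/
theorem weylFlux_le (hz : 0 < z.im) (n : ℕ) :
    J.weylFlux z n ≤ -(z.im * ‖J.fPlus z (n + 1)‖ ^ 2) := by
  obtain ⟨C, hC, ha, -⟩ := J.exists_bound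
  have hmono : Monotone (J.weylFlux z) := monotone_nat_of_le_succ fun k => by
    have := J.weylFlux_succ_sub (z := z) k
    have : 0 ≤ z.im * ‖J.fPlus z (k + 1)‖ ^ 2 := by positivity
    linarith
  have hlim : Tendsto (J.weylFlux z) atTop (𝓝 0) := by
    have hf := J.tendsto_fPlus hz
    have h1 := (((tendsto_add_atTop_iff_nat 1).2 hf).norm.mul hf.norm).const_mul (C + 1)
    refine squeeze_zero_norm (fun k => ?_) (by simpa using h1)
    rw [weylFlux, norm_mul, Real.norm_eq_abs, Real.norm_eq_abs, abs_of_pos (J.a_pos _)]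
    gcongr
    · exact (ha _).2
    · refine (Complex.abs_im_le_norm _).trans ?_
      rw [norm_mul, norm_star]
  have := hmono.ge_of_tendsto hlim (n + 1)
  have := J.weylFlux_succ_sub (z := z) n
  linarith

/-- At a zero the flux vanishes, so `weylFlux_le` forces the next value to vanish too; the recursion
then carries the zero back one site. -/
theorem fPlus_ne_zero (hz : 0 < z.im) (n : ℕ) : J.fPlus z n ≠ 0 := by
  induction n with
  | zero => simp [fPlus]
  | succ n ih =>
    intro h
    have h1 := J.weylFlux_le hz (n + 1)
    have h2 : J.fPlus z (n + 2) = 0 := by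
      simp only [weylFlux, h] at h1
      simp only [star_zero, mul_zero, Complex.zero_im] at h1
      have h3 : ‖J.fPlus z (n + 1 + 1)‖ ^ 2 ≤ 0 := by
        by_contra hc
        have := mul_pos hz (not_le.1 hc)
        linarith
      have h4 : ‖J.fPlus z (n + 1 + 1)‖ = 0 := by
        have := sq_nonneg ‖J.fPlus z (n + 1 + 1)‖
        exact pow_eq_zero_iff (two_ne_zero) |>.1 (le_antisymm h3 this)
      exact norm_eq_zero.1 h4
    have h3 := J.fPlus_rec (z := z) n
    rw [h, h2] at h3
    have ha : (J.a n : ℂ) ≠ 0 := by exact_mod_cast (J.a_pos _).ne'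
    have h4 : (J.a n : ℂ) * J.fPlus z n = 0 := by linear_combination h3
    exact ih ((mul_eq_zero.1 h4).resolve_left ha)

/-- The step ratio `f₊(n+1) / f₊(n)` of the Weyl solution. -/
noncomputable def weylRatio (z : ℂ) (n : ℕ) : ℂ := J.fPlus z (n + 1) / J.fPlus z n

theorem im_weylRatio_le (hz : 0 < z.im) (n : ℕ) :
    J.a n * (J.weylRatio z n).im ≤ -(z.im * ‖J.weylRatio z n‖ ^ 2) := by
  have h0 := J.fPlus_ne_zero hz n
  have hpos : 0 < ‖J.fPlus z n‖ ^ 2 := by positivity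
  have h1 : J.fPlus z (n + 1) = J.weylRatio z n * J.fPlus z n := by
    rw [weylRatio]; field_simp
  have h := J.weylFlux_le hz n
  rw [weylFlux, h1, mul_assoc, Complex.star_def, Complex.mul_conj, Complex.im_mul_ofReal,
    Complex.normSq_eq_norm_sq, norm_mul] at h
  refine le_of_mul_le_mul_right ?_ hpos
  linarith

theorem im_weylRatio_neg (hz : 0 < z.im) (n : ℕ) : (J.weylRatio z n).im < 0 := by
  have h := J.im_weylRatio_le hz n
  have h0 : 0 < ‖J.weylRatio z n‖ :=
    norm_pos_iff.2 (div_ne_zero (J.fPlus_ne_zero hz _) (J.fPlus_ne_zero hz _))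
  have h1 : 0 < z.im * ‖J.weylRatio z n‖ ^ 2 := by positivity
  by_contra hc
  have := mul_nonneg (J.a_pos n).le (not_lt.1 hc)
  linarith

theorem norm_weylRatio_le (hz : 0 < z.im) (n : ℕ) : ‖J.weylRatio z n‖ ≤ J.a n / z.im := by
  have h := J.im_weylRatio_le hz n
  have h0 : 0 < ‖J.weylRatio z n‖ :=
    norm_pos_iff.2 (div_ne_zero (J.fPlus_ne_zero hz _) (J.fPlus_ne_zero hz _))
  have h1 := mul_le_mul_of_nonneg_left
    ((neg_le_abs _).trans (Complex.abs_im_le_norm (J.weylRatio z n))) (J.a_pos n).le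
  rw [le_div_iff₀ hz]
  refine le_of_mul_le_mul_right ?_ h0
  linarith

/-- Since `a(n) m₊(n) = -f₊(n+1) / f₊(n)`, the real parts of the logarithms telescope. -/
theorem re_wPlus (hz : 0 < z.im) (N : ℕ) : (J.wPlus N z).re
    = (Real.log ‖J.fPlus z (N + 1)‖ - Real.log ‖J.fPlus z 1‖) / N := by
  have hterm : ∀ n, (Complex.log ((J.a n : ℂ) * J.mPlusAt n z)).re
      = Real.log ‖J.fPlus z (n + 1)‖ - Real.log ‖J.fPlus z n‖ := by
    intro n
    have ha : (J.a n : ℂ) ≠ 0 := by exact_mod_cast (J.a_pos _).ne'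
    have h0 := J.fPlus_ne_zero hz n
    have : (J.a n : ℂ) * J.mPlusAt n z = -(J.fPlus z (n + 1) / J.fPlus z n) := by
      rw [mPlusAt]; field_simp
    rw [this, Complex.log_re, norm_neg, norm_div,
      Real.log_div (norm_ne_zero_iff.2 (J.fPlus_ne_zero hz _)) (norm_ne_zero_iff.2 h0)]
  have hsum : ∑ n ∈ Finset.Icc 1 N, (Complex.log ((J.a n : ℂ) * J.mPlusAt n z)).re
      = Real.log ‖J.fPlus z (N + 1)‖ - Real.log ‖J.fPlus z 1‖ := by
    induction N with
    | zero => simp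
    | succ N ih =>
      rw [Finset.sum_Icc_succ_top (by omega), ih, hterm]
      ring
  rw [wPlus, show (1 / (N : ℂ)) = ((1 / (N : ℝ) : ℝ) : ℂ) by push_cast; rfl,
    Complex.re_ofReal_mul, Complex.re_sum, hsum]
  ring

end Weyl

end JacobiMatrix

/-! ### Orthogonal polynomials, their zeros and the Wronskian -/

namespace JacobiMatrix

variable (J : JacobiMatrix)

open Polynomial in
/-- The monic orthogonal polynomials of `J`, that is, the characteristic polynomials of its
truncations. -/
noncomputable def orthPoly : ℕ → Polynomial ℂ
  | 0 => 1
  | 1 => X - C (J.b 1 : ℂ)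
  | n + 2 => (X - C (J.b (n + 2) : ℂ)) * orthPoly (n + 1) - C ((J.a (n + 1) : ℂ) ^ 2) * orthPoly n

open Polynomial in
theorem orthPoly_monic_degree (n : ℕ) : ((J.orthPoly n).Monic ∧ (J.orthPoly n).degree = (n : WithBot ℕ)) ∧
    ((J.orthPoly (n + 1)).Monic ∧ (J.orthPoly (n + 1)).degree = ((n + 1 : ℕ) : WithBot ℕ)) := by
  induction n with
  | zero => exact ⟨⟨monic_one, by simp [orthPoly]⟩, ⟨monic_X_sub_C _, by simp [orthPoly]⟩⟩
  | succ n ih =>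
    refine ⟨ih.2, ?_⟩
    have h1 : ((X - C (J.b (n + 2) : ℂ)) * J.orthPoly (n + 1)).Monic :=
      (monic_X_sub_C _).mul ih.2.1
    have h2 : ((X - C (J.b (n + 2) : ℂ)) * J.orthPoly (n + 1)).degree = ((n + 2 : ℕ) : WithBot ℕ) := by
      rw [degree_mul, ih.2.2, degree_X_sub_C]
      norm_cast
      omega
    have h3 : (C ((J.a (n + 1) : ℂ) ^ 2) * J.orthPoly n).degree
        < ((X - C (J.b (n + 2) : ℂ)) * J.orthPoly (n + 1)).degree := by
      rw [h2, degree_C_mul (pow_ne_zero 2 (by exact_mod_cast (J.a_pos _).ne')), ih.1.2]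
      norm_cast
      omega
    rw [show n + 1 + 1 = n + 2 by rfl, orthPoly]
    exact ⟨h1.sub_of_left h3, by rw [degree_sub_eq_left_of_degree_lt h3, h2]⟩

variable {J} in
theorem eval_orthPoly_succ_succ (n : ℕ) (z : ℂ) : (J.orthPoly (n + 2)).eval z
    = (z - (J.b (n + 2) : ℂ)) * (J.orthPoly (n + 1)).eval z
      - (J.a (n + 1) : ℂ) ^ 2 * (J.orthPoly n).eval z := by
  simp [orthPoly]

theorem eval_conj_orthPoly (n : ℕ) (z : ℂ) :
    (J.orthPoly n).eval (star z) = star ((J.orthPoly n).eval z) := by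
  induction n using Nat.twoStepInduction with
  | zero => simp [orthPoly]
  | one => simp [orthPoly]
  | more n h1 h2 =>
    rw [eval_orthPoly_succ_succ, eval_orthPoly_succ_succ, h1, h2]
    simp

/-- Riccati form of the recursion. It survives a zero of the polynomial of degree `n`, because
division by zero gives zero and the last term is then zero on both readings. -/
theorem eval_orthPoly_succ_div {z : ℂ} {n : ℕ}
    (h1 : (J.orthPoly (n + 1)).eval z ≠ 0) :
    (J.orthPoly (n + 2)).eval z / (J.orthPoly (n + 1)).eval z
      = z - (J.b (n + 2) : ℂ)
        - ((J.a (n + 1) ^ 2 : ℝ) : ℂ) * ((J.orthPoly (n + 1)).eval z / (J.orthPoly n).eval z)⁻¹ := by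
  rw [eval_orthPoly_succ_succ]
  push_cast
  field_simp

/-- The Riccati map `q ↦ z - b - a²/q` preserves the half plane `Im q ≥ Im z`. -/
theorem im_orthPoly_ratio {z : ℂ} (hz : 0 < z.im) (n : ℕ) : (J.orthPoly n).eval z ≠ 0 ∧
    (J.orthPoly (n + 1)).eval z ≠ 0 ∧
    z.im ≤ ((J.orthPoly (n + 1)).eval z / (J.orthPoly n).eval z).im := by
  induction n with
  | zero =>
    refine ⟨by simp [orthPoly], fun h => ?_, by simp [orthPoly]⟩
    have := congrArg Complex.im h
    simp [orthPoly] at this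
    exact hz.ne' this
  | succ n ih =>
    have him : z.im ≤ ((J.orthPoly (n + 2)).eval z / (J.orthPoly (n + 1)).eval z).im := by
      rw [J.eval_orthPoly_succ_div ih.2.1]
      set q := (J.orthPoly (n + 1)).eval z / (J.orthPoly n).eval z
      have hq : 0 ≤ q.im / Complex.normSq q :=
        div_nonneg (hz.le.trans ih.2.2) (Complex.normSq_nonneg _)
      rw [Complex.sub_im, Complex.im_ofReal_mul, Complex.inv_im, neg_div]
      have := mul_nonneg (sq_nonneg (J.a (n + 1))) hq
      simp
      linarith
    refine ⟨ih.2.1, fun h => ?_, him⟩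
    rw [show n + 1 + 1 = n + 2 by rfl] at h
    rw [h] at him
    simp at him
    linarith

/-- The Riccati map also preserves `|q| ≥ C + 1`: here `|z - b| ≥ 2(C + 1)` and `a²/|q| ≤ C + 1`. -/
theorem norm_orthPoly_ratio {C : ℝ} (hC : 0 < C) (ha : ∀ n, J.a n ≤ C + 1)
    (hb : ∀ n, |J.b (n + 1)| ≤ C) {z : ℂ} (hz : 3 * C + 2 ≤ ‖z‖) (n : ℕ) :
    (J.orthPoly n).eval z ≠ 0 ∧ (J.orthPoly (n + 1)).eval z ≠ 0 ∧
    C + 1 ≤ ‖(J.orthPoly (n + 1)).eval z / (J.orthPoly n).eval z‖ := by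
  have hzb : ∀ n, 2 * (C + 1) ≤ ‖z - (J.b (n + 1) : ℂ)‖ := by
    intro n
    have h := norm_sub_norm_le z (J.b (n + 1) : ℂ)
    rw [Complex.norm_real, Real.norm_eq_abs] at h
    linarith [hb n]
  induction n with
  | zero =>
    have h := hzb 0
    refine ⟨by simp [orthPoly], fun h' => ?_, ?_⟩
    · simp [orthPoly] at h'
      simp [h'] at h
      linarith
    · simp [orthPoly] at h ⊢
      linarith
  | succ n ih =>
    have hn : C + 1 ≤ ‖(J.orthPoly (n + 2)).eval z / (J.orthPoly (n + 1)).eval z‖ := by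
      rw [J.eval_orthPoly_succ_div ih.2.1]
      set q := (J.orthPoly (n + 1)).eval z / (J.orthPoly n).eval z
      have h1 := norm_sub_norm_le (z - (J.b (n + 2) : ℂ)) (((J.a (n + 1) ^ 2 : ℝ) : ℂ) * q⁻¹)
      have h2 : ‖((J.a (n + 1) ^ 2 : ℝ) : ℂ) * q⁻¹‖ ≤ C + 1 := by
        rw [norm_mul, Complex.norm_real, Real.norm_eq_abs, abs_of_nonneg (sq_nonneg _), norm_inv,
          ← div_eq_mul_inv, div_le_iff₀ (by linarith [ih.2.2])]
        have := J.a_pos (n + 1)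
        have := ha (n + 1)
        have := ih.2.2
        calc J.a (n + 1) ^ 2 ≤ (C + 1) * (C + 1) := by nlinarith
          _ ≤ (C + 1) * ‖q‖ := by gcongr
      linarith [hzb (n + 1)]
    refine ⟨ih.2.1, fun h => ?_, hn⟩
    rw [show n + 1 + 1 = n + 2 by rfl] at h
    rw [h] at hn
    simp at hn
    linarith

theorem exists_real_zeros {C : ℝ} (hC : 0 < C) (ha : ∀ n, J.a n ≤ C + 1)
    (hb : ∀ n, |J.b (n + 1)| ≤ C) (n : ℕ) : ∃ x : Fin n → ℝ, (∀ i, |x i| ≤ 3 * C + 2) ∧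
    ∀ z : ℂ, (J.orthPoly n).eval z = ∏ i, (z - (x i : ℂ)) := by
  have hm := (J.orthPoly_monic_degree n).1
  have hsp := IsAlgClosed.splits (J.orthPoly n)
  have hcard : (J.orthPoly n).roots.toList.length = n := by
    rw [Multiset.length_toList, ← hsp.natDegree_eq_card_roots,
      Polynomial.natDegree_eq_of_degree_eq_some hm.2]
  have hfn : ∀ l : List ℂ, l.length = n → ∃ y : Fin n → ℂ, l = List.ofFn y := by
    rintro l rfl
    exact ⟨l.get, (List.ofFn_get l).symm⟩
  obtain ⟨y, hy⟩ := hfn _ hcard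
  have hys : (J.orthPoly n).roots = (List.ofFn y : Multiset ℂ) := by
    rw [← hy, Multiset.coe_toList]
  have hroot : ∀ w ∈ (J.orthPoly n).roots, w.im = 0 ∧ ‖w‖ ≤ 3 * C + 2 := by
    intro w hw
    have hw0 : (J.orthPoly n).eval w = 0 := (Polynomial.mem_roots'.1 hw).2
    constructor
    · rcases lt_trichotomy w.im 0 with h | h | h
      · exfalso
        refine (J.im_orthPoly_ratio (z := star w) (by simpa using h) n).1 ?_
        rw [eval_conj_orthPoly, hw0, star_zero]
      · exact h
      · exact absurd hw0 (J.im_orthPoly_ratio h n).1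
    · by_contra h
      exact (J.norm_orthPoly_ratio hC ha hb (not_le.1 h).le n).1 hw0
  have hmem : ∀ i, y i ∈ (J.orthPoly n).roots := fun i => by
    rw [hys, Multiset.mem_coe, List.mem_ofFn]
    exact ⟨i, rfl⟩
  have hre : ∀ i, (((y i).re : ℝ) : ℂ) = y i := fun i => Complex.ext rfl (hroot _ (hmem i)).1.symm
  refine ⟨fun i => (y i).re, fun i => (Complex.abs_re_le_norm _).trans (hroot _ (hmem i)).2,
    fun z => ?_⟩
  simp_rw [hre]
  rw [hsp.eval_eq_prod_roots_of_monic hm.1, hys, Multiset.map_coe, Multiset.prod_coe,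
    List.map_ofFn, List.prod_ofFn]
  rfl

section Weyl

variable {z : ℂ}

/-- Each step multiplies the left side by `a(n+1)`; the initial value is `a(0) f₊(0) = 1`. -/
theorem wronskian_orthPoly (n : ℕ) :
    J.fPlus z (n + 1) * (J.orthPoly (n + 1)).eval z
      - (J.a (n + 1) : ℂ) * J.fPlus z (n + 2) * (J.orthPoly n).eval z
      = ((∏ i ∈ Finset.range (n + 1), J.a i : ℝ) : ℂ) := by
  induction n with
  | zero =>
    have h := J.fPlus_rec (z := z) 0
    simp only [zero_add] at h ⊢
    rw [h, J.a_zero]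
    simp [orthPoly, J.a_zero, fPlus]
    ring
  | succ n ih =>
    have h := J.fPlus_rec (z := z) (n + 1)
    rw [Finset.prod_range_succ]
    push_cast at ih ⊢
    rw [← ih, eval_orthPoly_succ_succ]
    simp only [show n + 1 + 1 = n + 2 by rfl, show n + 1 + 2 = n + 3 by rfl] at h ⊢
    rw [h]
    ring

/-- The Wronskian factors as `f₊(n+1) Pₙ D`. Both terms of `D` have imaginary part of the same sign,
so `Im D ≥ Im z`, and the ratio bounds control `|D|` from above, uniformly in `n`. -/
theorem abs_log_fPlus_add_log_orthPoly_le (hz : 0 < z.im) : ∃ B : ℝ, ∀ n,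
    |Real.log ‖J.fPlus z (n + 1)‖ + Real.log ‖(J.orthPoly n).eval z‖
      - ∑ i ∈ Finset.range (n + 1), Real.log (J.a i)| ≤ B := by
  obtain ⟨C, hC, ha, hb⟩ := J.exists_bound
  -- The first three terms bound the polynomial ratio, the last one the Weyl ratio times `a(n+1)`.
  set U : ℝ := ‖z‖ + C + (C + 1) ^ 2 / z.im + (C + 1) ^ 2 / z.im
  refine ⟨max (Real.log U) (-Real.log z.im), fun n => ?_⟩
  set q : ℕ → ℂ := fun n => (J.orthPoly (n + 1)).eval z / (J.orthPoly n).eval z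
  have hqn : ∀ n, z.im ≤ ‖q n‖ := fun n =>
    (J.im_orthPoly_ratio hz n).2.2.trans ((le_abs_self _).trans (Complex.abs_im_le_norm _))
  have hC2 : ∀ n, J.a n ^ 2 ≤ (C + 1) ^ 2 := fun n =>
    pow_le_pow_left₀ (J.a_pos n).le (ha n).2 2
  have hzb : ∀ n, ‖z - (J.b (n + 1) : ℂ)‖ ≤ ‖z‖ + C := fun n => by
    refine (norm_sub_le _ _).trans ?_
    rw [Complex.norm_real, Real.norm_eq_abs]
    linarith [hb n]
  have hq : ‖q n‖ ≤ ‖z‖ + C + (C + 1) ^ 2 / z.im := by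
    have hC3 : 0 ≤ (C + 1) ^ 2 / z.im := by positivity
    cases n with
    | zero =>
      have := hzb 0
      simp only [q]
      simp [orthPoly] at this ⊢
      linarith
    | succ n =>
      have h := J.im_orthPoly_ratio hz n
      simp only [q]
      rw [J.eval_orthPoly_succ_div h.2.1]
      refine (norm_sub_le _ _).trans (add_le_add (hzb _) ?_)
      rw [norm_mul, Complex.norm_real, Real.norm_eq_abs, abs_of_nonneg (sq_nonneg _), norm_inv,
        ← div_eq_mul_inv]
      exact div_le_div₀ (by positivity) (hC2 _) hz (hqn n)
  set r := J.weylRatio z (n + 1)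
  have hr : ‖(J.a (n + 1) : ℂ) * r‖ ≤ (C + 1) ^ 2 / z.im := by
    rw [norm_mul, Complex.norm_real, Real.norm_eq_abs, abs_of_pos (J.a_pos _)]
    calc J.a (n + 1) * ‖r‖ ≤ J.a (n + 1) * (J.a (n + 1) / z.im) :=
          mul_le_mul_of_nonneg_left (J.norm_weylRatio_le hz _) (J.a_pos _).le
      _ = J.a (n + 1) ^ 2 / z.im := by ring
      _ ≤ _ := by exact div_le_div_of_nonneg_right (hC2 _) hz.le
  set D : ℂ := q n - (J.a (n + 1) : ℂ) * r
  have hDU : ‖D‖ ≤ U := (norm_sub_le _ _).trans (add_le_add hq hr)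
  have hDL : z.im ≤ ‖D‖ := by
    refine le_trans ?_ ((le_abs_self _).trans (Complex.abs_im_le_norm D))
    have h1 : J.a (n + 1) * r.im < 0 :=
      mul_neg_of_pos_of_neg (J.a_pos _) (J.im_weylRatio_neg hz _)
    have h2 : z.im ≤ (q n).im := (J.im_orthPoly_ratio hz n).2.2
    simp only [D, Complex.sub_im, Complex.im_ofReal_mul]
    linarith
  have hP := (J.im_orthPoly_ratio hz n).1
  have hf := J.fPlus_ne_zero hz (n + 1)
  have hprod : J.fPlus z (n + 1) * (J.orthPoly n).eval z * D
      = ((∏ i ∈ Finset.range (n + 1), J.a i : ℝ) : ℂ) := by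
    rw [← J.wronskian_orthPoly n]
    simp only [D, q, r, weylRatio]
    field_simp
  have hD0 : 0 < ‖D‖ := hz.trans_le hDL
  have hlog := congrArg (fun w : ℂ => Real.log ‖w‖) hprod
  simp only [norm_mul] at hlog
  rw [Complex.norm_real, Real.norm_eq_abs, Real.log_abs,
    Real.log_prod (fun i _ => (J.a_pos i).ne'),
    Real.log_mul (mul_ne_zero (norm_ne_zero_iff.2 hf) (norm_ne_zero_iff.2 hP)) hD0.ne',
    Real.log_mul (norm_ne_zero_iff.2 hf) (norm_ne_zero_iff.2 hP)] at hlog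
  have e : Real.log ‖J.fPlus z (n + 1)‖ + Real.log ‖(J.orthPoly n).eval z‖
      - ∑ i ∈ Finset.range (n + 1), Real.log (J.a i) = -Real.log ‖D‖ := by linarith
  rw [e, abs_neg, abs_le]
  have h1 := Real.log_le_log hz hDL
  have h2 := Real.log_le_log hD0 hDU
  constructor
  · linarith [le_max_right (Real.log U) (-Real.log z.im)]
  · exact h2.trans (le_max_left _ _)

end Weyl

end JacobiMatrix

/-! ### Zero distributions and the Thouless formula -/

theorem continuous_log_norm_sub_ofReal {z : ℂ} (hz : z ∈ upperHalf) :
    Continuous fun s : ℝ => Real.log ‖z - (s : ℂ)‖ := by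
  refine Continuous.log (by fun_prop) fun s h => ?_
  have := congrArg Complex.im (norm_eq_zero.1 h)
  simp at this
  exact (ne_of_gt hz) this

namespace JacobiMatrix

variable (J : JacobiMatrix)

theorem exists_zeros_measure {C : ℝ} (hC : 0 < C) (ha : ∀ n, J.a n ≤ C + 1)
    (hb : ∀ n, |J.b (n + 1)| ≤ C) (N : ℕ) :
    ∃ κ : ProbabilityMeasure (Icc (-(3 * C + 2)) (3 * C + 2)), ∀ z ∈ upperHalf,
      N * ∫ s, Real.log ‖z - ((s : ℝ) : ℂ)‖ ∂(κ : Measure (Icc (-(3 * C + 2)) (3 * C + 2)))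
        = Real.log ‖(J.orthPoly N).eval z‖ := by
  rcases Nat.eq_zero_or_pos N with rfl | hN
  -- For `N = 0` any probability measure serves, as both sides vanish.
  · exact ⟨⟨Measure.dirac ⟨0, by constructor <;> linarith⟩, inferInstance⟩,
      fun z _ => by simp [orthPoly]⟩
  obtain ⟨x, hx, hP⟩ := J.exists_real_zeros hC ha hb N
  set y : Fin N → Icc (-(3 * C + 2)) (3 * C + 2) := fun i => ⟨x i, abs_le.1 (hx i)⟩
  have hN0 : (N : ℝ≥0∞) ≠ 0 := by exact_mod_cast hN.ne'
  set μ : Measure (Icc (-(3 * C + 2)) (3 * C + 2)) := (N : ℝ≥0∞)⁻¹ • ∑ i, Measure.dirac (y i)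
  have hμ : IsProbabilityMeasure μ := ⟨by
    simp only [μ, Measure.smul_apply, Measure.finsetSum_apply, measure_univ, Finset.sum_const,
      Finset.card_univ, Fintype.card_fin, smul_eq_mul, nsmul_eq_mul, mul_one]
    exact ENNReal.inv_mul_cancel hN0 (ENNReal.natCast_ne_top N)⟩
  refine ⟨⟨μ, hμ⟩, fun z hz => ?_⟩
  have hcont := (continuous_log_norm_sub_ofReal hz).comp
    (continuous_subtype_val (p := fun s : ℝ => s ∈ Icc (-(3 * C + 2)) (3 * C + 2)))
  have hne : ∀ i, ‖z - (x i : ℂ)‖ ≠ 0 := fun i h => by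
    have := congrArg Complex.im (norm_eq_zero.1 h)
    simp at this
    exact (ne_of_gt hz) this
  change N * ∫ s, Real.log ‖z - ((s : ℝ) : ℂ)‖ ∂μ = _
  have hN1 : (N : ℝ) ≠ 0 := by exact_mod_cast hN.ne'
  rw [integral_smul_measure, integral_finsetSum_measure
    (fun i _ => integrable_dirac (by exact enorm_lt_top))]
  simp_rw [integral_dirac]
  rw [hP, norm_prod, Real.log_prod (fun i _ => hne i)]
  simp only [ENNReal.toReal_inv, ENNReal.toReal_natCast, smul_eq_mul, y]
  field_simp

/-- Eventually `|f₊| ≤ 1`, and the fixed term `ln |f₊(1)|` of the telescoped sum disappears after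
division by `N`. -/
theorem lyapunovUpper_nonneg {Nseq : ℕ → ℕ} (hN : Tendsto Nseq atTop atTop) {w : ℂ → ℂ}
    {z : ℂ} (hz : z ∈ upperHalf) (hw : Tendsto (fun j => J.wPlus (Nseq j) z) atTop (𝓝 (w z))) :
    0 ≤ lyapunovUpper w z := by
  have h1 : Tendsto (fun j => (J.wPlus (Nseq j) z).re) atTop (𝓝 (w z).re) :=
    (Complex.continuous_re.tendsto _).comp hw
  have h2 : Tendsto (fun j => -Real.log ‖J.fPlus z 1‖ / (Nseq j : ℝ)) atTop (𝓝 0) :=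
    (tendsto_natCast_atTop_atTop.comp hN).const_div_atTop _
  have h3 : ∀ᶠ j in atTop, ‖J.fPlus z (Nseq j + 1)‖ ≤ 1 := by
    have h : Tendsto (fun n => ‖J.fPlus z (n + 1)‖) atTop (𝓝 0) := by
      simpa using ((tendsto_add_atTop_iff_nat 1).2 (J.tendsto_fPlus hz)).norm
    exact hN.eventually (h.eventually_le_const one_pos)
  have h4 : (w z).re ≤ 0 := by
    refine le_of_tendsto_of_tendsto h1 h2 ?_
    filter_upwards [h3] with j hj
    rw [J.re_wPlus hz]
    have := Real.log_nonpos (norm_nonneg _) hj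
    gcongr
    linarith
  rw [lyapunovUpper]
  linarith

theorem exists_thouless {Nseq : ℕ → ℕ} (hN : Tendsto Nseq atTop atTop) {w : ℂ → ℂ}
    (hw : ∀ z ∈ upperHalf, Tendsto (fun j => J.wPlus (Nseq j) z) atTop (𝓝 (w z))) :
    ∃ (κ : Measure ℝ) (R A : ℝ), IsProbabilityMeasure κ ∧ 0 ≤ R ∧ (∀ᵐ s ∂κ, |s| ≤ R) ∧
      ∀ z ∈ upperHalf, lyapunovUpper w z = ∫ s, Real.log ‖z - (s : ℂ)‖ ∂κ - A := by
  obtain ⟨C, hC, ha, hb⟩ := J.exists_bound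
  choose κ hκ using J.exists_zeros_measure hC (fun n => (ha n).2) hb
  set c : ℕ → ℝ := fun N => (∑ i ∈ Finset.range (N + 1), Real.log (J.a i)) / N
  set L := Real.log (C + 1)
  -- There are `N + 1` summands but the divisor is `N`, hence the factor `2`.
  have hc : ∀ᶠ j in atTop, c (Nseq j) ∈ Icc (-(2 * L)) (2 * L) := by
    filter_upwards [hN.eventually_ge_atTop 1] with j hj
    have hj' : (1 : ℝ) ≤ Nseq j := by exact_mod_cast hj
    have hL : 0 ≤ L := Real.log_nonneg (by linarith)
    have hlog : ∀ i, |Real.log (J.a i)| ≤ L := fun i => by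
      rw [abs_le]
      refine ⟨?_, Real.log_le_log (J.a_pos i) (ha i).2⟩
      rw [← Real.log_inv]
      exact Real.log_le_log (by positivity) (ha i).1
    rw [mem_Icc, ← abs_le]
    simp only [c]
    rw [abs_div, abs_of_nonneg (by linarith : (0 : ℝ) ≤ Nseq j), div_le_iff₀ (by linarith)]
    refine (Finset.abs_sum_le_sum_abs _ _).trans ((Finset.sum_le_sum fun i _ => hlog i).trans ?_)
    simp
    nlinarith
  -- An ultrafilter replaces subsequences: along it the zero distributions, living on a fixed
  -- compact interval, and the averages of `ln a` both converge, for all `z` at once.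
  set U : Ultrafilter ℕ := Ultrafilter.of atTop
  have hU : (U : Filter ℕ) ≤ atTop := Ultrafilter.of_le _
  obtain ⟨A, -, hA⟩ := isCompact_Icc.ultrafilter_le_nhds' (U.map fun j => c (Nseq j)) (hU hc)
  have hA' : Tendsto (fun j => c (Nseq j)) U (𝓝 A) := hA
  have hlim : Tendsto (fun j => κ (Nseq j)) U (𝓝 (U.map fun j => κ (Nseq j)).lim) :=
    (U.map fun j => κ (Nseq j)).le_nhds_lim
  set k := (U.map fun j => κ (Nseq j)).lim
  have hmeas : Measurable (Subtype.val : Icc (-(3 * C + 2)) (3 * C + 2) → ℝ) :=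
    measurable_subtype_coe
  refine ⟨(k : Measure _).map Subtype.val, 3 * C + 2, A,
    Measure.isProbabilityMeasure_map hmeas.aemeasurable, by positivity, ?_, fun z hz => ?_⟩
  · rw [ae_map_iff hmeas.aemeasurable (measurableSet_le (by fun_prop) (by fun_prop))]
    exact Eventually.of_forall fun s => abs_le.2 s.2
  · have hcont := continuous_log_norm_sub_ofReal hz
    rw [integral_map hmeas.aemeasurable hcont.aestronglyMeasurable]
    set φ : BoundedContinuousFunction (Icc (-(3 * C + 2)) (3 * C + 2)) ℝ :=
      BoundedContinuousFunction.mkOfCompact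
        ⟨fun s => Real.log ‖z - ((s : ℝ) : ℂ)‖, hcont.comp continuous_subtype_val⟩
    have h1 := (ProbabilityMeasure.tendsto_iff_forall_integral_tendsto.1 hlim) φ
    obtain ⟨B, hB⟩ := J.abs_log_fPlus_add_log_orthPoly_le hz
    have hNU : Tendsto (fun j => (Nseq j : ℝ)) U atTop :=
      (tendsto_natCast_atTop_atTop.comp hN).mono_left hU
    have h2 : Tendsto (fun j => -(J.wPlus (Nseq j) z).re) U (𝓝 (-(w z).re)) :=
      (((Complex.continuous_re.tendsto _).comp (hw z hz)).mono_left hU).neg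
    refine tendsto_nhds_unique h2 ?_
    have h3 := (h1.sub hA')
    have h4 : Tendsto (fun j => -(J.wPlus (Nseq j) z).re
        - (∫ s, φ s ∂(κ (Nseq j) : Measure _) - c (Nseq j))) U (𝓝 0) := by
      refine squeeze_zero_norm' ?_
        (hNU.const_div_atTop (B + |Real.log ‖J.fPlus z 1‖|))
      filter_upwards [hNU.eventually_ge_atTop 1] with j hj
      have hj0 : (0 : ℝ) < Nseq j := by linarith
      have e1 : ∫ s, φ s ∂(κ (Nseq j) : Measure _)
          = Real.log ‖(J.orthPoly (Nseq j)).eval z‖ / Nseq j := by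
        rw [eq_div_iff hj0.ne', mul_comm]
        exact hκ (Nseq j) z hz
      rw [e1, J.re_wPlus hz, Real.norm_eq_abs, le_div_iff₀ hj0, ← abs_of_pos hj0, ← abs_mul,
        abs_of_pos hj0]
      have e2 : (-((Real.log ‖J.fPlus z (Nseq j + 1)‖ - Real.log ‖J.fPlus z 1‖) / (Nseq j : ℝ))
          - (Real.log ‖(J.orthPoly (Nseq j)).eval z‖ / Nseq j - c (Nseq j))) * Nseq j
          = -(Real.log ‖J.fPlus z (Nseq j + 1)‖ + Real.log ‖(J.orthPoly (Nseq j)).eval z‖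
            - ∑ i ∈ Finset.range (Nseq j + 1), Real.log (J.a i)) + Real.log ‖J.fPlus z 1‖ := by
        simp only [c]
        field_simp
        ring
      rw [e2]
      refine (abs_add_le _ _).trans ?_
      rw [abs_neg]
      gcongr
      exact hB _
    have h5 := h4.add h3
    simp only [sub_add_cancel, zero_add] at h5
    exact h5

end JacobiMatrix

/-! ### Boundary values and upper semicontinuity -/

theorem ofReal_add_mul_I_mem {t y : ℝ} (hy : 0 < y) : (t : ℂ) + (y : ℂ) * Complex.I ∈ upperHalf := by
  simpa [upperHalf] using hy

theorem continuousOn_lyapunovUpper {w : ℂ → ℂ} (hw : IsHerglotz w) :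
    ContinuousOn (lyapunovUpper w) upperHalf :=
  (Complex.continuous_re.comp_continuousOn hw.1.continuousOn).neg

theorem norm_add_mul_I_sub_le {t y s R : ℝ} (hy : 0 ≤ y) (hy1 : y ≤ 1) (hs : |s| ≤ R) :
    ‖(t : ℂ) + (y : ℂ) * Complex.I - (s : ℂ)‖ ≤ |t| + R + 1 := by
  have h1 : ‖(t : ℂ) + (y : ℂ) * Complex.I - (s : ℂ)‖ ≤ ‖(t : ℂ)‖ + ‖(y : ℂ) * Complex.I‖ + ‖(s : ℂ)‖ :=
    (norm_sub_le _ _).trans (add_le_add_left (norm_add_le _ _) _)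
  simp only [norm_mul, Complex.norm_I, Complex.norm_real, Real.norm_eq_abs, mul_one,
    abs_of_nonneg hy] at h1
  linarith

theorem abs_sub_le_norm_add_mul_I_sub (t y s : ℝ) :
    |t - s| ≤ ‖(t : ℂ) + (y : ℂ) * Complex.I - (s : ℂ)‖ := by
  simpa using Complex.abs_re_le_norm ((t : ℂ) + (y : ℂ) * Complex.I - (s : ℂ))

theorem tendsto_norm_add_mul_I_sub (t s : ℝ) :
    Tendsto (fun y : ℝ => ‖(t : ℂ) + (y : ℂ) * Complex.I - (s : ℂ)‖) (𝓝[>] 0) (𝓝 |t - s|) := by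
  have h : Continuous fun y : ℝ => ‖(t : ℂ) + (y : ℂ) * Complex.I - (s : ℂ)‖ := by fun_prop
  have h0 := (h.tendsto 0).mono_left (nhdsWithin_le_nhds (s := Ioi 0))
  have e : ‖(t : ℂ) + ((0 : ℝ) : ℂ) * Complex.I - (s : ℂ)‖ = |t - s| := by
    rw [Complex.ofReal_zero, zero_mul, add_zero, ← Complex.ofReal_sub, Complex.norm_real,
      Real.norm_eq_abs]
  rwa [e] at h0

/-- A representation of the Lyapunov exponent as a logarithmic potential. -/
structure IsThouless (w : ℂ → ℂ) (κ : Measure ℝ) (R A : ℝ) : Prop where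
  prob : IsProbabilityMeasure κ
  nonneg_radius : 0 ≤ R
  bounded : ∀ᵐ s ∂κ, |s| ≤ R
  eq_integral : ∀ z ∈ upperHalf, lyapunovUpper w z = ∫ s, Real.log ‖z - (s : ℂ)‖ ∂κ - A
  nonneg : ∀ z ∈ upperHalf, 0 ≤ lyapunovUpper w z

namespace IsThouless

variable {w : ℂ → ℂ} {κ : Measure ℝ} {R A : ℝ}

theorem log_norm_le {t y s : ℝ} (hy : 0 < y) (hy1 : y ≤ 1) (hs : |s| ≤ R) :
    Real.log ‖(t : ℂ) + (y : ℂ) * Complex.I - (s : ℂ)‖ ≤ Real.log (|t| + R + 1) := by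
  refine Real.log_le_log ?_ (norm_add_mul_I_sub_le hy.le hy1 hs)
  refine hy.trans_le ((le_abs_self _).trans ?_)
  simpa using Complex.abs_im_le_norm ((t : ℂ) + (y : ℂ) * Complex.I - (s : ℂ))

theorem integrable_upper (h : IsThouless w κ R A) {t y : ℝ} (hy : 0 < y) (hy1 : y ≤ 1) :
    Integrable (fun s : ℝ => Real.log ‖(t : ℂ) + (y : ℂ) * Complex.I - (s : ℂ)‖) κ := by
  have := h.prob
  refine Integrable.of_mem_Icc (Real.log y) (Real.log (|t| + R + 1))
    (continuous_log_norm_sub_ofReal (ofReal_add_mul_I_mem hy)).aemeasurable ?_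
  filter_upwards [h.bounded] with s hs
  refine ⟨Real.log_le_log hy ((le_abs_self _).trans ?_), log_norm_le hy hy1 hs⟩
  simpa using Complex.abs_im_le_norm ((t : ℂ) + (y : ℂ) * Complex.I - (s : ℂ))

theorem lintegral_upper_le (h : IsThouless w κ R A) {t y : ℝ} (hy : 0 < y) (hy1 : y ≤ 1) :
    ∫⁻ s, ENNReal.ofReal (Real.log (|t| + R + 1)
        - Real.log ‖(t : ℂ) + (y : ℂ) * Complex.I - (s : ℂ)‖) ∂κ
      ≤ ENNReal.ofReal (Real.log (|t| + R + 1) - A) := by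
  have := h.prob
  rw [← ofReal_integral_eq_lintegral_ofReal (f := fun s : ℝ => Real.log (|t| + R + 1)
    - Real.log ‖(t : ℂ) + (y : ℂ) * Complex.I - (s : ℂ)‖)
    ((integrable_const _).sub (h.integrable_upper hy hy1))]
  · refine ENNReal.ofReal_le_ofReal ?_
    rw [integral_sub (integrable_const _) (h.integrable_upper hy hy1)]
    have h1 := h.eq_integral _ (ofReal_add_mul_I_mem (t := t) hy)
    have h2 := h.nonneg _ (ofReal_add_mul_I_mem (t := t) hy)
    simp
    linarith
  · filter_upwards [h.bounded] with s hs
    exact sub_nonneg.2 (log_norm_le hy hy1 hs)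

/-- Fatou's lemma as `y → 0+` for the nonnegative kernels `M - ln |t + iy - s|`, whose integrals are
at most `M - A` because `γ ≥ 0`. -/
theorem ae_ne_and_integrable (h : IsThouless w κ R A) (t : ℝ) :
    (∀ᵐ s ∂κ, s ≠ t) ∧ Integrable (fun s => Real.log |t - s|) κ := by
  have := h.prob
  set M := Real.log (|t| + R + 1)
  obtain ⟨y, -, hy, hlim⟩ := exists_seq_strictAnti_tendsto' (show (0 : ℝ) < 1 from one_pos)
  have hlim' : Tendsto y atTop (𝓝[>] 0) :=
    tendsto_nhdsWithin_iff.2 ⟨hlim, Eventually.of_forall fun n => (hy n).1⟩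
  set F : ℕ → ℝ → ℝ≥0∞ := fun n s =>
    ENNReal.ofReal (M - Real.log ‖(t : ℂ) + (y n : ℂ) * Complex.I - (s : ℂ)‖)
  -- `Real.log 0 = 0` would hide the singularity; the value `⊤` at `s = t` is what excludes an atom.
  set K : ℝ → ℝ≥0∞ := fun s => if s = t then ⊤ else ENNReal.ofReal (M - Real.log |t - s|)
  have hF : ∀ s, Tendsto (fun n => F n s) atTop (𝓝 (K s)) := by
    intro s
    have h1 := (tendsto_norm_add_mul_I_sub t s).comp hlim'
    by_cases hs : s = t
    · subst hs
      simp only [K, if_true]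
      refine ENNReal.tendsto_ofReal_nhds_top.2 ?_
      refine tendsto_atTop_add_const_left _ M (tendsto_neg_atBot_atTop.comp ?_)
      refine Real.tendsto_log_nhdsGT_zero.comp (tendsto_nhdsWithin_iff.2 ⟨?_, ?_⟩)
      · simpa [Function.comp_def] using h1
      · refine Eventually.of_forall fun n => ?_
        have := (hy n).1
        simp [this.ne']
    · simp only [K, if_neg hs]
      have h2 : |t - s| ≠ 0 := abs_ne_zero.2 (sub_ne_zero.2 (Ne.symm hs))
      exact ENNReal.tendsto_ofReal (tendsto_const_nhds.sub (h1.log h2))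
  have hK : ∫⁻ s, K s ∂κ ≤ ENNReal.ofReal (M - A) := by
    calc ∫⁻ s, K s ∂κ = ∫⁻ s, liminf (fun n => F n s) atTop ∂κ :=
          lintegral_congr fun s => (hF s).liminf_eq.symm
      _ ≤ liminf (fun n => ∫⁻ s, F n s ∂κ) atTop := lintegral_liminf_le fun n => by
          simp only [F]
          fun_prop
      _ ≤ liminf (fun _ => ENNReal.ofReal (M - A)) (atTop : Filter ℕ) := by
          refine liminf_le_liminf (Eventually.of_forall fun n => ?_)
          exact h.lintegral_upper_le (hy n).1 (hy n).2.le
      _ = ENNReal.ofReal (M - A) := liminf_const _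
  have hKm : Measurable K := Measurable.ite (measurableSet_singleton t) measurable_const
    (by fun_prop)
  have hfin : ∫⁻ s, K s ∂κ ≠ ⊤ := (hK.trans_lt ENNReal.ofReal_lt_top).ne
  have hne : ∀ᵐ s ∂κ, s ≠ t := by
    filter_upwards [ae_lt_top hKm hfin] with s hs hst
    simp [K, hst] at hs
  refine ⟨hne, ?_⟩
  have hint : Integrable (fun s => M - Real.log |t - s|) κ := by
    refine (lintegral_ofReal_ne_top_iff_integrable
      (Measurable.aestronglyMeasurable (by fun_prop)) ?_).1 ?_
    · filter_upwards [h.bounded, hne] with s hs hst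
      refine sub_nonneg.2 (Real.log_le_log (abs_pos.2 (sub_ne_zero.2 hst.symm)) ?_)
      have := abs_sub t s
      linarith
    · refine ne_top_of_le_ne_top hfin (lintegral_mono fun s => ?_)
      simp only [K]
      split_ifs with hs
      · exact le_top
      · exact le_rfl
  refine ((integrable_const M).sub hint).congr (Eventually.of_forall fun s => ?_)
  simp

/-- Dominated convergence: `ln |t + iy - s|` lies between the integrable `ln |t - s|` and a
constant. -/
theorem tendsto_boundary (h : IsThouless w κ R A) (t : ℝ) :
    Tendsto (fun y : ℝ => lyapunovUpper w ((t : ℂ) + (y : ℂ) * Complex.I)) (𝓝[>] 0)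
      (𝓝 (∫ s, Real.log |t - s| ∂κ - A)) := by
  have := h.prob
  obtain ⟨hne, hint⟩ := h.ae_ne_and_integrable t
  have h1 : Tendsto (fun y : ℝ => ∫ s, Real.log ‖(t : ℂ) + (y : ℂ) * Complex.I - (s : ℂ)‖ ∂κ)
      (𝓝[>] 0) (𝓝 (∫ s, Real.log |t - s| ∂κ)) := by
    refine tendsto_integral_filter_of_dominated_convergence
      (fun s => ‖Real.log |t - s|‖ + |Real.log (|t| + R + 1)|)
      (Eventually.of_forall fun y => Measurable.aestronglyMeasurable (by fun_prop))
      ?_ (hint.norm.add (integrable_const _)) ?_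
    · filter_upwards [Ioc_mem_nhdsGT (show (0 : ℝ) < 1 from one_pos)] with y hy
      filter_upwards [h.bounded, hne] with s hs hst
      have hlo := Real.log_le_log (abs_pos.2 (sub_ne_zero.2 hst.symm))
        (abs_sub_le_norm_add_mul_I_sub t y s)
      have hhi := log_norm_le (t := t) hy.1 hy.2 hs
      rw [Real.norm_eq_abs, Real.norm_eq_abs, abs_le]
      constructor
      · linarith [neg_abs_le (Real.log |t - s|), abs_nonneg (Real.log (|t| + R + 1))]
      · linarith [le_abs_self (Real.log (|t| + R + 1)), abs_nonneg (Real.log |t - s|)]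
    · filter_upwards [hne] with s hst
      exact (tendsto_norm_add_mul_I_sub t s).log (abs_ne_zero.2 (sub_ne_zero.2 hst.symm))
  refine (h1.sub_const A).congr' ?_
  filter_upwards [self_mem_nhdsWithin] with y hy
  exact (h.eq_integral _ (ofReal_add_mul_I_mem hy)).symm

theorem lyapunov_eq (h : IsThouless w κ R A) (t : ℝ) :
    lyapunov w t = ∫ s, Real.log |t - s| ∂κ - A :=
  (h.tendsto_boundary t).limUnder_eq

theorem tendsto_lyapunov (h : IsThouless w κ R A) (t : ℝ) :
    Tendsto (fun y : ℝ => lyapunovUpper w ((t : ℂ) + (y : ℂ) * Complex.I)) (𝓝[>] 0)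
      (𝓝 (lyapunov w t)) := by
  rw [h.lyapunov_eq]
  exact h.tendsto_boundary t

theorem lyapunov_le (h : IsThouless w κ R A) (t : ℝ) {y : ℝ} (hy : 0 < y) (hy1 : y ≤ 1) :
    lyapunov w t ≤ lyapunovUpper w ((t : ℂ) + (y : ℂ) * Complex.I) := by
  obtain ⟨hne, hint⟩ := h.ae_ne_and_integrable t
  rw [h.lyapunov_eq, h.eq_integral _ (ofReal_add_mul_I_mem hy)]
  refine sub_le_sub_right (integral_mono_ae hint (h.integrable_upper hy hy1) ?_) _
  filter_upwards [hne] with s hst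
  exact Real.log_le_log (abs_pos.2 (sub_ne_zero.2 hst.symm)) (abs_sub_le_norm_add_mul_I_sub t y s)

theorem continuous_lyapunovUpper_line (hw : IsHerglotz w) {y : ℝ} (hy : 0 < y) :
    Continuous fun t : ℝ => lyapunovUpper w ((t : ℂ) + (y : ℂ) * Complex.I) :=
  (continuousOn_lyapunovUpper hw).comp_continuous (by fun_prop) fun _ => ofReal_add_mul_I_mem hy

/-- On the real line `γ` lies below the continuous functions `γ(· + iδ)`, which converge to it at
`x`. -/
theorem eventually_lyapunov_lt (h : IsThouless w κ R A) (hw : IsHerglotz w) (x : ℝ) {ε : ℝ}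
    (hε : 0 < ε) : ∀ᶠ y in 𝓝 x, lyapunov w y < lyapunov w x + ε := by
  have h1 := (h.tendsto_lyapunov x).eventually_lt_const (lt_add_of_pos_right (lyapunov w x) hε)
  obtain ⟨δ, hδ, hδ0⟩ := (h1.and (Ioc_mem_nhdsGT (show (0 : ℝ) < 1 from one_pos))).exists
  filter_upwards [((continuous_lyapunovUpper_line hw hδ0.1).tendsto x).eventually_lt_const hδ]
    with y hy
  exact (h.lyapunov_le y hδ0.1 hδ0.2).trans_lt hy

theorem measurable_lyapunov (h : IsThouless w κ R A) (hw : IsHerglotz w) :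
    Measurable (lyapunov w) := by
  obtain ⟨y, -, hy, hlim⟩ := exists_seq_strictAnti_tendsto' (show (0 : ℝ) < 1 from one_pos)
  have hlim' : Tendsto y atTop (𝓝[>] 0) :=
    tendsto_nhdsWithin_iff.2 ⟨hlim, Eventually.of_forall fun n => (hy n).1⟩
  refine measurable_of_tendsto_metrizable (fun n =>
    (continuous_lyapunovUpper_line hw (hy n).1).measurable) (tendsto_pi_nhds.2 fun t => ?_)
  exact (h.tendsto_lyapunov t).comp hlim'

end IsThouless

/-! ### The logarithmic kernel and measures with bounded potential -/

/-- The nonnegative part of the kernel `-ln |s - t|`. -/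
noncomputable def logKernel (s t : ℝ) : ℝ≥0∞ := (-ENNReal.log (edist s t)).toENNReal

theorem continuous_logKernel : Continuous fun p : ℝ × ℝ => logKernel p.1 p.2 := by
  unfold logKernel
  refine Continuous.ereal_toENNReal (continuous_neg.comp (ENNReal.continuous_log.comp ?_))
  fun_prop

theorem logKernel_self (s : ℝ) : logKernel s s = ⊤ := by
  simp [logKernel]

theorem log_edist_of_ne {s t : ℝ} (h : s ≠ t) :
    ENNReal.log (edist s t) = ((Real.log |s - t| : ℝ) : EReal) := by
  rw [edist_dist, Real.dist_eq, ENNReal.log_ofReal_of_pos (abs_pos.2 (sub_ne_zero.2 h))]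

theorem logKernel_of_ne {s t : ℝ} (h : s ≠ t) :
    logKernel s t = ENNReal.ofReal (-Real.log |s - t|) := by
  rw [logKernel, log_edist_of_ne h, ← EReal.coe_neg, EReal.real_coe_toENNReal]

theorem ofReal_sub_log_le (M s t : ℝ) :
    ENNReal.ofReal (M - Real.log |s - t|) ≤ ENNReal.ofReal M + logKernel s t := by
  by_cases h : s = t
  · rw [h, logKernel_self]
    simp
  · rw [logKernel_of_ne h, sub_eq_add_neg]
    exact ENNReal.ofReal_add_le

/-- The triangle inequality gives `|s - t'| ≤ 2 |s - t|`. Applied with `t'` a point nearest to `t`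
in the support, this extends a potential bound from the support to the whole line. -/
theorem logKernel_le_of_nearest {s t t' : ℝ} (h : |t - t'| ≤ |t - s|) :
    logKernel s t ≤ logKernel s t' + ENNReal.ofReal (Real.log 2) := by
  by_cases hs' : s = t'
  · rw [hs', logKernel_self]
    simp
  by_cases hs : s = t
  · subst hs
    rw [sub_self, abs_zero] at h
    exact absurd (sub_eq_zero.1 (abs_nonpos_iff.1 h)) hs'
  rw [logKernel_of_ne hs, logKernel_of_ne hs']
  refine le_trans (ENNReal.ofReal_le_ofReal ?_) ENNReal.ofReal_add_le
  have h0 : 0 < |s - t| := abs_pos.2 (sub_ne_zero.2 hs)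
  have h1 : |s - t'| ≤ 2 * |s - t| := by
    have := abs_sub_le s t t'
    rw [abs_sub_comm t s] at h
    linarith
  have h2 := Real.log_le_log (abs_pos.2 (sub_ne_zero.2 hs')) h1
  rw [Real.log_mul two_ne_zero h0.ne'] at h2
  linarith

/-- The nonnegative part of the energy `-∬ ln |s - t| dμ(s) dμ(t)`. -/
noncomputable def posEnergy (μ : Measure ℝ) : ℝ≥0∞ := ∫⁻ t, ∫⁻ s, logKernel s t ∂μ ∂μ

theorem measurable_potential (μ : Measure ℝ) [SFinite μ] :
    Measurable fun t => ∫⁻ s, logKernel s t ∂μ :=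
  Measurable.lintegral_prod_left' (f := fun p : ℝ × ℝ => logKernel p.1 p.2)
    continuous_logKernel.measurable

/-- A measure of finite energy has a restriction to a compact set of mass at least `1/4` whose
potential is bounded everywhere. -/
theorem exists_compact_potential_le {μ : Measure ℝ} [IsProbabilityMeasure μ] {K : Set ℝ}
    (hK : IsCompact K) (hμK : μ Kᶜ = 0) {c : ℝ} (hc : 0 < c)
    (hE : posEnergy μ ≤ ENNReal.ofReal c) :
    ∃ K' ⊆ K, IsCompact K' ∧ 4⁻¹ ≤ μ K' ∧
      ∀ t, ∫⁻ s in K', logKernel s t ∂μ ≤ ENNReal.ofReal (2 * c + Real.log 2) := by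
  have hφ := measurable_potential μ
  set φ : ℝ → ℝ≥0∞ := fun t => ∫⁻ s, logKernel s t ∂μ
  have h2c : (0 : ℝ) < 2 * c := by positivity
  -- Markov's inequality at twice the energy bound keeps half of the mass; settling for `1/4` leaves
  -- room for inner regularity.
  have hmarkov : μ {t | ENNReal.ofReal (2 * c) ≤ φ t} ≤ 2⁻¹ := by
    refine (meas_ge_le_lintegral_div hφ.aemeasurable (by simpa using hc)
      ENNReal.ofReal_ne_top).trans ((ENNReal.div_le_div_right hE _).trans ?_)
    rw [← ENNReal.ofReal_div_of_pos h2c, show c / (2 * c) = 2⁻¹ by field_simp,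
      ENNReal.ofReal_inv_of_pos two_pos]
    simp
  set E := {t | φ t < ENNReal.ofReal (2 * c)} ∩ K
  have hEm : MeasurableSet E := (measurableSet_lt hφ measurable_const).inter hK.measurableSet
  have hμE : 4⁻¹ < μ E := by
    have h1 : μ Eᶜ ≤ 2⁻¹ := by
      refine le_trans (measure_mono (t := {t | ENNReal.ofReal (2 * c) ≤ φ t} ∪ Kᶜ) ?_)
        ((measure_union_le _ _).trans (by rw [hμK, add_zero]; exact hmarkov))
      intro t ht
      simp only [E, compl_inter, mem_union, mem_compl_iff, mem_ofPred_eq, not_lt] at ht ⊢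
      exact ht
    have h2 : (1 : ℝ≥0∞) ≤ μ E + 2⁻¹ := by
      rw [← prob_add_prob_compl (μ := μ) hEm]
      gcongr
    by_contra hcon
    have h3 : (1 : ℝ≥0∞) ≤ 4⁻¹ + 2⁻¹ := h2.trans (by gcongr; exact not_lt.1 hcon)
    have h4 := ENNReal.toReal_mono (by simp) h3
    rw [ENNReal.toReal_add (by simp) (by simp)] at h4
    norm_num at h4
  obtain ⟨K', hK'E, hK', hμK'⟩ := hEm.exists_lt_isCompact hμE
  refine ⟨K', hK'E.trans inter_subset_right, hK', hμK'.le, fun t => ?_⟩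
  have hne : K'.Nonempty := by
    by_contra h
    rw [not_nonempty_iff_eq_empty.1 h, measure_empty] at hμK'
    exact absurd hμK' (by simp)
  obtain ⟨t', ht', hd⟩ := hK'.exists_infDist_eq_dist hne t
  calc ∫⁻ s in K', logKernel s t ∂μ
      ≤ ∫⁻ s in K', (logKernel s t' + ENNReal.ofReal (Real.log 2)) ∂μ := by
        refine setLIntegral_mono' hK'.measurableSet fun s hs => logKernel_le_of_nearest ?_
        rw [← Real.dist_eq, ← Real.dist_eq, ← hd]
        exact Metric.infDist_le_dist_of_mem hs
    _ ≤ φ t' + ENNReal.ofReal (Real.log 2) := by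
        rw [lintegral_add_right _ measurable_const]
        gcongr
        · exact setLIntegral_le_lintegral _ _
        · rw [setLIntegral_const]
          exact mul_le_of_le_one_right' prob_le_one
    _ ≤ ENNReal.ofReal (2 * c) + ENNReal.ofReal (Real.log 2) := by
        gcongr
        exact (hK'E ht').1.le
    _ = _ := (ENNReal.ofReal_add h2c.le (Real.log_nonneg (by norm_num))).symm

/-! ### Measures on deviation sets have large energy -/

namespace IsThouless

variable {w : ℂ → ℂ} {κ : Measure ℝ} {R A : ℝ}

theorem log_abs_sub_le {x y s : ℝ} (hy : |y - x| ≤ 1) (hs : |s| ≤ R) (hsy : s ≠ y) :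
    Real.log |y - s| ≤ Real.log (|x| + R + 2) := by
  refine Real.log_le_log (abs_pos.2 (sub_ne_zero.2 hsy.symm)) ?_
  have h1 := abs_sub y s
  have h2 := abs_sub_abs_le_abs_sub y x
  linarith

theorem lintegral_eq (h : IsThouless w κ R A) {x y : ℝ} (hy : |y - x| ≤ 1) :
    0 ≤ Real.log (|x| + R + 2) - A - lyapunov w y ∧
    ∫⁻ s, ENNReal.ofReal (Real.log (|x| + R + 2) - Real.log |y - s|) ∂κ
      = ENNReal.ofReal (Real.log (|x| + R + 2) - A - lyapunov w y) := by
  have := h.prob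
  obtain ⟨hne, hint⟩ := h.ae_ne_and_integrable y
  have hpos : 0 ≤ᵐ[κ] fun s => Real.log (|x| + R + 2) - Real.log |y - s| := by
    filter_upwards [h.bounded, hne] with s hs hsy
    exact sub_nonneg.2 (log_abs_sub_le hy hs hsy)
  have e : ∫ s, (Real.log (|x| + R + 2) - Real.log |y - s|) ∂κ
      = Real.log (|x| + R + 2) - A - lyapunov w y := by
    rw [integral_sub (integrable_const _) hint, h.lyapunov_eq y]
    simp
  refine ⟨e ▸ integral_nonneg_of_ae hpos, ?_⟩
  rw [← e]
  exact (ofReal_integral_eq_lintegral_ofReal ((integrable_const _).sub hint) hpos).symm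

/-- Compares the potentials of `κ` at `x` and on `K`, averaged over a part of `μ` with bounded
potential. The two scales matter: `K` lies within `r²` of `x`, while charges are split at distance
`r`. -/
theorem deviation_le (h : IsThouless w κ R A) {x ε r c : ℝ} (hε : 0 < ε) (hr : 0 < r)
    (hr1 : r < 1) {K : Set ℝ} (hK : IsCompact K)
    (hKx : ∀ y ∈ K, |y - x| ≤ r ^ 2 ∧ lyapunov w y ≤ lyapunov w x - ε)
    {μ : Measure ℝ} [IsProbabilityMeasure μ] (hμK : μ Kᶜ = 0) (hc : 0 < c)
    (hE : posEnergy μ ≤ ENNReal.ofReal c) :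
    ε / 4 ≤ -Real.log (1 - r)
      + (Real.log (|x| + R + 2) + (2 * c + Real.log 2)) * κ.real (Ioo (x - r) (x + r)) := by
  have := h.prob
  obtain ⟨K', hK'K, hK', hm, hpot⟩ := exists_compact_potential_le hK hμK hc hE
  set M := Real.log (|x| + R + 2)
  have hM : 0 ≤ M := Real.log_nonneg (by linarith [abs_nonneg x, h.nonneg_radius])
  have hlog2 : 0 ≤ Real.log 2 := Real.log_nonneg (by norm_num)
  have hlogr : 0 ≤ -Real.log (1 - r) := neg_nonneg.2 (Real.log_nonpos (by linarith) (by linarith))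
  have hr2 : r ^ 2 ≤ 1 := by nlinarith
  set Φ : ℝ≥0∞ := ∫⁻ s, ENNReal.ofReal (M - Real.log |x - s|) ∂κ
  obtain ⟨hx0, hΦ⟩ := h.lintegral_eq (x := x) (y := x) (by simp)
  have hΦtop : Φ ≠ ⊤ := by
    simp only [Φ]
    rw [hΦ]
    exact ENNReal.ofReal_ne_top
  set B := Ioo (x - r) (x + r)
  set D : ℝ≥0∞ := ENNReal.ofReal (-Real.log (1 - r))
  set T : ℝ≥0∞ := ENNReal.ofReal (M + (2 * c + Real.log 2))
  have lower : (Φ + ENNReal.ofReal ε) * μ K'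
      ≤ ∫⁻ y in K', ∫⁻ s, ENNReal.ofReal (M - Real.log |y - s|) ∂κ ∂μ := by
    rw [← setLIntegral_const]
    refine setLIntegral_mono' hK'.measurableSet fun y hy => ?_
    have hy' := hKx y (hK'K hy)
    rw [(h.lintegral_eq (hy'.1.trans hr2)).2]
    simp only [Φ]
    rw [hΦ, ← ENNReal.ofReal_add hx0 hε.le]
    exact ENNReal.ofReal_le_ofReal (by linarith [hy'.2])
  have hmeas : Measurable fun p : ℝ × ℝ => ENNReal.ofReal (M - Real.log |p.1 - p.2|) := by
    fun_prop
  rw [lintegral_lintegral_swap hmeas.aemeasurable] at lower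
  have pointwise : ∀ s, ∫⁻ y in K', ENNReal.ofReal (M - Real.log |y - s|) ∂μ
      ≤ (ENNReal.ofReal (M - Real.log |x - s|) + D) * μ K' + B.indicator (fun _ => T) s := by
    intro s
    by_cases hs : s ∈ B
    · refine le_trans ?_ le_add_self
      rw [indicator_of_mem hs]
      calc ∫⁻ y in K', ENNReal.ofReal (M - Real.log |y - s|) ∂μ
          ≤ ∫⁻ y in K', (ENNReal.ofReal M + logKernel y s) ∂μ :=
            lintegral_mono fun y => ofReal_sub_log_le M y s
        _ ≤ ENNReal.ofReal M + ENNReal.ofReal (2 * c + Real.log 2) := by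
            rw [lintegral_add_left measurable_const, setLIntegral_const]
            gcongr
            · exact mul_le_of_le_one_right' prob_le_one
            · exact hpot s
        _ = T := (ENNReal.ofReal_add hM (by positivity)).symm
    · refine le_trans ?_ le_self_add
      rw [← setLIntegral_const]
      refine setLIntegral_mono' hK'.measurableSet fun y hy => ?_
      refine le_trans (ENNReal.ofReal_le_ofReal ?_) ENNReal.ofReal_add_le
      have hsx : r ≤ |x - s| := by
        by_contra hcon
        rw [not_le, abs_lt] at hcon
        exact hs ⟨by linarith [hcon.2], by linarith [hcon.1]⟩
      -- Far charges: `|y - x| ≤ r² ≤ r |x - s|`.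
      have hys : (1 - r) * |x - s| ≤ |y - s| := by
        have h1 := abs_sub_le x y s
        have h2 := (hKx y (hK'K hy)).1
        rw [abs_sub_comm] at h2
        nlinarith
      have h1r : 0 < 1 - r := by linarith
      have hxs : 0 < |x - s| := hr.trans_le hsx
      have h3 := Real.log_le_log (mul_pos h1r hxs) hys
      rw [Real.log_mul h1r.ne' hxs.ne'] at h3
      linarith
  have upper : ∫⁻ s, ∫⁻ y in K', ENNReal.ofReal (M - Real.log |y - s|) ∂μ ∂κ
      ≤ (Φ + D) * μ K' + T * κ B := by
    refine (lintegral_mono pointwise).trans ?_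
    rw [lintegral_add_right _ (measurable_const.indicator measurableSet_Ioo),
      lintegral_mul_const _ (by fun_prop), lintegral_add_right _ measurable_const,
      lintegral_indicator_const measurableSet_Ioo, lintegral_const, measure_univ, mul_one]
  have h1 := lower.trans upper
  rw [add_mul, add_mul, add_assoc] at h1
  have hΦm : Φ * μ K' ≠ ⊤ := ENNReal.mul_ne_top hΦtop (measure_ne_top _ _)
  -- The potential at `x` is finite and cancels, leaving only the gain `ε` against the two error
  -- terms.
  have h2 := (ENNReal.add_le_add_iff_left hΦm).1 h1
  have h3 : ENNReal.ofReal ε * 4⁻¹ ≤ D + T * κ B :=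
    (mul_le_mul_right hm _).trans (h2.trans (by gcongr; exact mul_le_of_le_one_right' prob_le_one))
  have h4 := ENNReal.toReal_mono (by finiteness) h3
  rw [ENNReal.toReal_add (by finiteness) (by finiteness), ENNReal.toReal_mul, ENNReal.toReal_mul,
    ENNReal.toReal_ofReal hε.le, ENNReal.toReal_ofReal hlogr,
    ENNReal.toReal_ofReal (by positivity)] at h4
  simpa [div_eq_mul_inv, Measure.real] using h4

theorem tendsto_measure_Ioo (h : IsThouless w κ R A) (x : ℝ) :
    Tendsto (fun r => κ (Ioo (x - r) (x + r))) (𝓝[>] 0) (𝓝 0) := by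
  have := h.prob
  have h0 : κ (⋂ r > (0 : ℝ), Ioo (x - r) (x + r)) = 0 := by
    refine measure_mono_null (t := {s | ¬ s ≠ x}) (fun s hs => ?_) (h.ae_ne_and_integrable x).1
    simp only [mem_iInter, mem_Ioo] at hs
    simp only [ne_eq, not_not, mem_ofPred_eq]
    refine le_antisymm (le_of_forall_pos_le_add fun r hr => (hs r hr).2.le)
      (le_of_forall_pos_le_add fun r hr => ?_)
    linarith [(hs r hr).1]
  rw [← h0]
  refine tendsto_measure_biInter_gt (fun r _ => measurableSet_Ioo.nullMeasurableSet)
    (fun i j _ hij => Ioo_subset_Ioo (by linarith) (by linarith)) ⟨1, one_pos, measure_ne_top _ _⟩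

/-- For `|x - s| < r` one has `ln (1/r) ≤ -ln |x - s|`, and the integral of the latter over a
shrinking interval tends to zero. -/
theorem tendsto_log_mul_measure_Ioo (h : IsThouless w κ R A) (x : ℝ) :
    Tendsto (fun r => -Real.log r * κ.real (Ioo (x - r) (x + r))) (𝓝[>] 0) (𝓝 0) := by
  have := h.prob
  obtain ⟨hne, hint⟩ := h.ae_ne_and_integrable x
  have hlim : Tendsto (fun r => ∫ s in Ioo (x - r) (x + r), -Real.log |x - s| ∂κ) (𝓝[>] 0) (𝓝 0) :=
    hint.neg.tendsto_setIntegral_nhds_zero (h.tendsto_measure_Ioo x)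
  refine tendsto_of_tendsto_of_tendsto_of_le_of_le' tendsto_const_nhds hlim ?_ ?_
  · filter_upwards [Ioc_mem_nhdsGT (show (0 : ℝ) < 1 from one_pos)] with r hr
    exact mul_nonneg (neg_nonneg.2 (Real.log_nonpos hr.1.le hr.2)) measureReal_nonneg
  · filter_upwards [self_mem_nhdsWithin] with r hr
    have e : -Real.log r * κ.real (Ioo (x - r) (x + r))
        = ∫ s in Ioo (x - r) (x + r), -Real.log r ∂κ := by
      rw [setIntegral_const, smul_eq_mul, mul_comm]
    rw [e]
    refine integral_mono_ae (integrable_const _) hint.neg.integrableOn ?_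
    filter_upwards [ae_restrict_of_ae hne, ae_restrict_mem measurableSet_Ioo] with s hs hsr
    refine neg_le_neg (Real.log_le_log (abs_pos.2 (sub_ne_zero.2 hs.symm)) ?_)
    rw [abs_le]
    exact ⟨by linarith [hsr.2], by linarith [hsr.1]⟩

/-- Probability measures on small deviation sets have large energy. -/
theorem eventually_lt_posEnergy (h : IsThouless w κ R A) (hw : IsHerglotz w) (x : ℝ) {ε N : ℝ}
    (hε : 0 < ε) (hN : 0 < N) : ∀ᶠ η in 𝓝[>] (0 : ℝ), ∀ (μ : Measure ℝ) (K : Set ℝ),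
      IsProbabilityMeasure μ → IsCompact K →
      K ⊆ deviationSet (lyapunov w) x ε ∩ Ioo (x - η) (x + η) → μ Kᶜ = 0 →
      ENNReal.ofReal (N * -Real.log η) < posEnergy μ := by
  have := h.prob
  -- `deviation_le` is used with `r = √η`, so that `r²` is the radius of the deviation set.
  have hsqrt : Tendsto Real.sqrt (𝓝[>] 0) (𝓝[>] 0) :=
    tendsto_nhdsWithin_iff.2 ⟨by
      have h0 := (Real.continuous_sqrt.tendsto 0).mono_left (nhdsWithin_le_nhds (s := Ioi 0))
      rwa [Real.sqrt_zero] at h0, by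
      filter_upwards [self_mem_nhdsWithin] with η hη
      exact Real.sqrt_pos.2 hη⟩
  set M := Real.log (|x| + R + 2)
  have hlim : Tendsto (fun r => -Real.log (1 - r)
      + (M + (2 * (N * -Real.log (r ^ 2)) + Real.log 2)) * κ.real (Ioo (x - r) (x + r)))
      (𝓝[>] 0) (𝓝 0) := by
    have h1 : Tendsto (fun r : ℝ => -Real.log (1 - r)) (𝓝[>] 0) (𝓝 0) := by
      have : ContinuousAt (fun r : ℝ => -Real.log (1 - r)) 0 := by
        refine ContinuousAt.neg (ContinuousAt.log (by fun_prop) (by norm_num))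
      simpa using this.tendsto.mono_left (nhdsWithin_le_nhds (s := Ioi 0))
    have h2 : Tendsto (fun r => κ.real (Ioo (x - r) (x + r))) (𝓝[>] 0) (𝓝 0) := by
      simpa [Measure.real, Function.comp_def] using
        (ENNReal.tendsto_toReal ENNReal.zero_ne_top).comp (h.tendsto_measure_Ioo x)
    -- The factor `4 * N` arises from `2 * c` with `c = N ln (1/r²)`.
    have h3 := h1.add ((h2.const_mul (M + Real.log 2)).add
      ((h.tendsto_log_mul_measure_Ioo x).const_mul (4 * N)))
    simp only [mul_zero, add_zero] at h3
    refine h3.congr fun r => ?_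
    rw [Real.log_pow]
    push_cast
    ring
  -- Semicontinuity excludes upward deviations, so the deviation set has `γ(y) ≤ γ(x) - ε`.
  have husc : ∀ᶠ η in 𝓝[>] (0 : ℝ), ∀ y ∈ Ioo (x - η) (x + η),
      lyapunov w y < lyapunov w x + ε := by
    obtain ⟨δ, hδ, hball⟩ := Metric.eventually_nhds_iff.1 (h.eventually_lyapunov_lt hw x hε)
    filter_upwards [Ioc_mem_nhdsGT hδ] with η hη y hy
    refine hball ?_
    rw [Real.dist_eq, abs_lt]
    exact ⟨by linarith [hy.1, hη.2], by linarith [hy.2, hη.2]⟩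
  filter_upwards [husc, (hlim.comp hsqrt).eventually_lt_const (show (0 : ℝ) < ε / 4 by positivity),
    Ioo_mem_nhdsGT (show (0 : ℝ) < 1 from one_pos)] with η h1 h2 hη μ K hμ hK hKs hμK
  by_contra hcon
  rw [not_lt] at hcon
  have hsq : Real.sqrt η ^ 2 = η := Real.sq_sqrt hη.1.le
  have hr1 : Real.sqrt η < 1 := by
    rw [Real.sqrt_lt' one_pos]
    simpa using hη.2
  have hc : 0 < N * -Real.log η := mul_pos hN (neg_pos.2 (Real.log_neg hη.1 hη.2))
  have h3 := h.deviation_le (x := x) hε (Real.sqrt_pos.2 hη.1) hr1 hK (fun y hy => ?_) hμK hc hcon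
  · simp only [Function.comp_apply] at h2
    rw [hsq] at h2
    linarith
  · have hy1 := (hKs hy).2
    have hy2 : ε ≤ |lyapunov w y - lyapunov w x| := (hKs hy).1
    refine ⟨?_, ?_⟩
    · rw [hsq, abs_le]
      exact ⟨by linarith [hy1.1], by linarith [hy1.2]⟩
    · have h4 := h1 y hy1
      rcases abs_cases (lyapunov w y - lyapunov w x) with hcase | hcase <;> linarith

end IsThouless

/-! ### Energies at small scale and of normalized Lebesgue measure -/

theorem logEnergy_eq_neg_posEnergy {μ : Measure ℝ} {K : Set ℝ}
    (hμK : μ Kᶜ = 0) (hdiam : ∀ s ∈ K, ∀ t ∈ K, |s - t| ≤ 1) :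
    logEnergy μ = -(posEnergy μ : EReal) := by
  have hae : ∀ᵐ s ∂μ, s ∈ K := by
    rw [ae_iff]
    exact hμK
  have h0 : ∫⁻ t, ∫⁻ s, (ENNReal.log (edist s t)).toENNReal ∂μ ∂μ = 0 := by
    rw [lintegral_eq_zero_of_ae_eq_zero]
    filter_upwards [hae] with t ht
    simp only [Pi.zero_apply]
    rw [lintegral_eq_zero_of_ae_eq_zero]
    filter_upwards [hae] with s hs
    simp only [Pi.zero_apply]
    rw [EReal.toENNReal_eq_zero_iff, ENNReal.log_le_zero_iff, edist_dist, Real.dist_eq,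
      ENNReal.ofReal_le_one]
    exact hdiam s hs t ht
  unfold logEnergy
  rw [h0]
  simp only [EReal.coe_ennreal_zero, zero_sub]
  rfl

theorem lintegral_logKernel_Ioo (t : ℝ) {r : ℝ} (hr : 0 < r) (hr1 : r ≤ 1) :
    ∫⁻ s in Ioo (t - r) (t + r), logKernel s t = ENNReal.ofReal (2 * r * (1 - Real.log r)) := by
  have hle : t - r ≤ t + r := by linarith
  have hint : IntervalIntegrable (fun s => -Real.log (s - t)) volume (t - r) (t + r) := by
    have h := (intervalIntegral.intervalIntegrable_log' (a := -r) (b := r)).comp_sub_right t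
    rw [show -r + t = t - r by ring, add_comm r t] at h
    exact h.neg
  have hint' : IntegrableOn (fun s => -Real.log (s - t)) (Ioo (t - r) (t + r)) :=
    ((intervalIntegrable_iff_integrableOn_Ioo_of_le hle).1 hint)
  have e1 : ∫⁻ s in Ioo (t - r) (t + r), logKernel s t
      = ∫⁻ s in Ioo (t - r) (t + r), ENNReal.ofReal (-Real.log (s - t)) := by
    refine lintegral_congr_ae ?_
    filter_upwards [ae_restrict_of_ae (Measure.ae_ne volume t)] with s hs
    rw [logKernel_of_ne hs, Real.log_abs]
  have hpos : 0 ≤ᵐ[volume.restrict (Ioo (t - r) (t + r))] fun s => -Real.log (s - t) := by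
    filter_upwards [ae_restrict_mem measurableSet_Ioo] with s hs
    rw [Pi.zero_apply, ← Real.log_abs]
    refine neg_nonneg.2 (Real.log_nonpos (abs_nonneg _) (abs_le.2 ⟨?_, ?_⟩))
    · linarith [hs.1]
    · linarith [hs.2]
  rw [e1, ← ofReal_integral_eq_lintegral_ofReal hint' hpos]
  congr 1
  rw [← integral_Ioc_eq_integral_Ioo, ← intervalIntegral.integral_of_le hle,
    intervalIntegral.integral_neg, intervalIntegral.integral_comp_sub_right (fun u => Real.log u) t,
    integral_log, show t + r - t = r by ring, show t - r - t = -r by ring, Real.log_neg_eq_log]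
  ring

/-- Seen from any of its points, `K` lies in an interval of radius `2η`, over which the kernel
integrates explicitly. -/
theorem posEnergy_cond_le {x η : ℝ} (hη : 0 < η) (hη1 : 2 * η ≤ 1) {K : Set ℝ}
    (hK : MeasurableSet K) (hK0 : volume K ≠ 0) (hKx : K ⊆ Ioo (x - η) (x + η)) :
    posEnergy ((volume K)⁻¹ • volume.restrict K)
      ≤ (volume K)⁻¹ * ENNReal.ofReal (2 * (2 * η) * (1 - Real.log (2 * η))) := by
  have hKtop : volume K ≠ ⊤ := ne_top_of_le_ne_top (by simp) (measure_mono hKx)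
  set Q := ENNReal.ofReal (2 * (2 * η) * (1 - Real.log (2 * η)))
  have hin : ∀ t ∈ K, ∫⁻ s in K, logKernel s t ≤ Q := by
    intro t ht
    simp only [Q]
    rw [← lintegral_logKernel_Ioo t (by positivity) hη1]
    refine lintegral_mono_set fun s hs => ?_
    have h1 := hKx ht
    have h2 := hKx hs
    exact ⟨by linarith [h1.2, h2.1], by linarith [h1.1, h2.2]⟩
  unfold posEnergy
  simp only [lintegral_smul_measure, smul_eq_mul]
  gcongr
  calc ∫⁻ t in K, (volume K)⁻¹ * ∫⁻ s in K, logKernel s t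
      ≤ ∫⁻ t in K, (volume K)⁻¹ * Q :=
        setLIntegral_mono' hK fun t ht => mul_le_mul_right (hin t ht) _
    _ = Q := by
        rw [setLIntegral_const, mul_right_comm, ENNReal.inv_mul_cancel hK0 hKtop, one_mul]

/-! ### Capacity bound and approximate continuity -/

namespace IsThouless

variable {w : ℂ → ℂ} {κ : Measure ℝ} {R A : ℝ}

theorem eventually_logCapacity_le (h : IsThouless w κ R A) (hw : IsHerglotz w) (x : ℝ) {ε N : ℝ}
    (hε : 0 < ε) (hN : 0 < N) : ∀ᶠ η in 𝓝[>] (0 : ℝ),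
      logCapacity (deviationSet (lyapunov w) x ε ∩ Ioo (x - η) (x + η)) ≤ ENNReal.ofReal (η ^ N) := by
  filter_upwards [h.eventually_lt_posEnergy hw x hε hN,
    Ioo_mem_nhdsGT (show (0 : ℝ) < 1 / 2 by norm_num)] with η h1 hη
  refine iSup₂_le fun μ hμ => ?_
  obtain ⟨hprob, K, hK, hKs, hμK⟩ := hμ
  rw [logEnergy_eq_neg_posEnergy hμK fun s hs t ht => ?_]
  · have h2 := (h1 μ K hprob hK hKs hμK).le
    have e : ENNReal.ofReal (η ^ N) = EReal.exp (-((N * -Real.log η : ℝ) : EReal)) := by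
      rw [← EReal.coe_neg, EReal.exp_coe, Real.rpow_def_of_pos hη.1]
      congr 2
      ring
    rw [e]
    refine EReal.exp_monotone (EReal.neg_le_neg_iff.2 ?_)
    have h0 : 0 ≤ N * -Real.log η := mul_nonneg hN.le
      (neg_nonneg.2 (Real.log_nonpos hη.1.le (by linarith [hη.2])))
    have h3 : ((ENNReal.ofReal (N * -Real.log η) : ℝ≥0∞) : EReal) ≤ (posEnergy μ : EReal) :=
      EReal.coe_ennreal_le_coe_ennreal_iff.2 h2
    rwa [EReal.coe_ennreal_ofReal, max_eq_left h0] at h3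
  · have h1 := (hKs hs).2
    have h2 := (hKs ht).2
    rw [abs_le]
    exact ⟨by linarith [h1.1, h2.2, hη.2], by linarith [h1.2, h2.1, hη.2]⟩

theorem tendsto_logCapacity_div (h : IsThouless w κ R A) (hw : IsHerglotz w) (x : ℝ) {ε N : ℝ}
    (hε : 0 < ε) (hN : 0 < N) : Tendsto (fun η : ℝ =>
      logCapacity (deviationSet (lyapunov w) x ε ∩ Ioo (x - η) (x + η)) / ENNReal.ofReal (η ^ N))
      (𝓝[>] 0) (𝓝 0) := by
  have hlim : Tendsto (fun η : ℝ => ENNReal.ofReal η) (𝓝[>] 0) (𝓝 0) := by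
    have h0 := (ENNReal.continuous_ofReal.tendsto 0).mono_left (nhdsWithin_le_nhds (s := Ioi 0))
    rwa [ENNReal.ofReal_zero] at h0
  refine tendsto_of_tendsto_of_tendsto_of_le_of_le' tendsto_const_nhds hlim
    (Eventually.of_forall fun _ => zero_le) ?_
  -- The bound with exponent `N + 1` leaves a spare factor `η`, turning `O` into `o`.
  filter_upwards [h.eventually_logCapacity_le hw x hε (add_pos hN one_pos), self_mem_nhdsWithin]
    with η h1 hη
  have hη0 : (0 : ℝ) < η := hη
  refine ENNReal.div_le_of_le_mul (h1.trans_eq ?_)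
  rw [← ENNReal.ofReal_mul hη0.le, Real.rpow_add hη0, Real.rpow_one, mul_comm]

/-- If the deviation set had density above `δ` at scale `η`, normalized Lebesgue measure on a
compact part would have energy at most `(4/δ) ln (1/η)`, contradicting `eventually_lt_posEnergy`
with `N = 4/δ`. -/
theorem isApproxContinuousAt (h : IsThouless w κ R A) (hw : IsHerglotz w) (x : ℝ) :
    IsApproxContinuousAt (lyapunov w) x := by
  have hm := h.measurable_lyapunov hw
  refine ⟨hm, fun ε hε => ENNReal.tendsto_nhds_zero.2 fun δ' hδ' => ?_⟩
  obtain ⟨δ, hδ0, hδδ'⟩ : ∃ δ : ℝ, 0 < δ ∧ ENNReal.ofReal δ ≤ δ' := by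
    obtain ⟨q, hq0, hq⟩ := ENNReal.lt_iff_exists_nnreal_btwn.1 hδ'
    exact ⟨q, by exact_mod_cast hq0, by simpa using hq.le⟩
  filter_upwards [h.eventually_lt_posEnergy hw x hε (show 0 < 4 / δ by positivity),
    -- This threshold ensures both `2η ≤ 1` and `ln (1/η) ≥ 1`; the latter absorbs the additive
    -- constant in the energy.
    Ioo_mem_nhdsGT (show (0 : ℝ) < Real.exp (-1) / 2 by positivity)] with η h1 hη
  refine le_trans ?_ hδδ'
  have hexp : Real.exp (-1) ≤ 1 := Real.exp_le_one_iff.2 (by norm_num)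
  have hη1 : 2 * η ≤ 1 := by linarith [hη.2]
  have hlog : 1 ≤ -Real.log η := by
    have := Real.log_le_log hη.1 (show η ≤ Real.exp (-1) by linarith [hη.2, Real.exp_pos (-1)])
    rw [Real.log_exp] at this
    linarith
  refine ENNReal.div_le_of_le_mul ?_
  rw [← ENNReal.ofReal_mul hδ0.le]
  by_contra hcon
  rw [not_le] at hcon
  set S := deviationSet (lyapunov w) x ε ∩ Ioo (x - η) (x + η)
  have hS : MeasurableSet S :=
    (measurableSet_le measurable_const (by fun_prop)).inter measurableSet_Ioo
  obtain ⟨K, hKS, hK, hvK⟩ := hS.exists_lt_isCompact hcon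
  have hv0 : 0 < δ * (2 * η) := mul_pos hδ0 (by linarith [hη.1])
  have hK0 : volume K ≠ 0 := (bot_lt_of_lt hvK).ne'
  have hKtop : volume K ≠ ⊤ := hK.measure_lt_top.ne
  have hprob : IsProbabilityMeasure ((volume K)⁻¹ • volume.restrict K) := ⟨by
    simp [ENNReal.inv_mul_cancel hK0 hKtop]⟩
  have hnull : ((volume K)⁻¹ • volume.restrict K) Kᶜ = 0 := by
    simp [Measure.restrict_apply hK.measurableSet.compl]
  have h2 := h1 _ K hprob hK hKS hnull
  have h3 := posEnergy_cond_le hη.1 hη1 hK.measurableSet hK0 (hKS.trans inter_subset_right)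
  refine absurd (h2.trans_le h3) (not_lt.2 ?_)
  calc (volume K)⁻¹ * ENNReal.ofReal (2 * (2 * η) * (1 - Real.log (2 * η)))
      ≤ (ENNReal.ofReal (δ * (2 * η)))⁻¹
          * ENNReal.ofReal (2 * (2 * η) * (1 - Real.log (2 * η))) := by gcongr
    _ = ENNReal.ofReal (2 / δ * (1 - Real.log (2 * η))) := by
        rw [← ENNReal.ofReal_inv_of_pos hv0, ← ENNReal.ofReal_mul (by positivity)]
        congr 1
        have := hη.1.ne'
        field_simp
    _ ≤ ENNReal.ofReal (4 / δ * -Real.log η) := by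
        refine ENNReal.ofReal_le_ofReal ?_
        rw [Real.log_mul two_ne_zero hη.1.ne']
        have hl2 : 0 ≤ Real.log 2 := Real.log_nonneg (by norm_num)
        calc 2 / δ * (1 - (Real.log 2 + Real.log η)) ≤ 2 / δ * (2 * -Real.log η) := by
              gcongr
              linarith
          _ = _ := by ring

end IsThouless

theorem JacobiMatrix.ConvergesAlong.tendsto {J : JacobiMatrix} {Nseq : ℕ → ℕ} {w : ℂ → ℂ}
    (hw : J.ConvergesAlong Nseq w) {z : ℂ} (hz : z ∈ upperHalf) :
    Tendsto (fun j => J.wPlus (Nseq j) z) atTop (𝓝 (w z)) :=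
  (hw.2 {z} isCompact_singleton (singleton_subset_iff.2 hz)).tendsto_at (mem_singleton z)

theorem JacobiMatrix.exists_isThouless (J : JacobiMatrix) {Nseq : ℕ → ℕ}
    (hN : Tendsto Nseq atTop atTop) {w : ℂ → ℂ} (hw : J.ConvergesAlong Nseq w) :
    ∃ (κ : Measure ℝ) (R A : ℝ), IsThouless w κ R A := by
  obtain ⟨κ, R, A, h1, h2, h3, h4⟩ := J.exists_thouless hN fun z hz => hw.tendsto hz
  exact ⟨κ, R, A, h1, h2, h3, h4, fun z hz => J.lyapunovUpper_nonneg hN hz (hw.tendsto hz)⟩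

/-- Existence of the boundary values `γ(t)` is part of the conclusion; the first of the two claims
is `cap [A(x, ε; γ) ∩ (x-h, x+h)] = o(h^N)` as `h → 0+`. -/
theorem theorem4p3 (J : JacobiMatrix) (Nseq : ℕ → ℕ) (hN : Tendsto Nseq atTop atTop)
    (w : ℂ → ℂ) (hw : J.ConvergesAlong Nseq w) :
    (∀ t : ℝ, Tendsto (fun y : ℝ => lyapunovUpper w ((t : ℂ) + (y : ℂ) * Complex.I))
        (𝓝[>] 0) (𝓝 (lyapunov w t))) ∧
    (∀ x ε N : ℝ, 0 < ε → 1 ≤ N →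
      Tendsto (fun h : ℝ =>
          logCapacity (deviationSet (lyapunov w) x ε ∩ Ioo (x - h) (x + h))
            / ENNReal.ofReal (h ^ N))
        (𝓝[>] 0) (𝓝 0)) ∧
    (∀ x : ℝ, IsApproxContinuousAt (lyapunov w) x) := by
  obtain ⟨κ, R, A, h⟩ := J.exists_isThouless hN hw
  exact ⟨h.tendsto_lyapunov,
    fun x _ _ hε hN => h.tendsto_logCapacity_div hw.1 x hε (one_pos.trans_le hN),
    h.isApproxContinuousAt hw.1⟩
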